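/- Call a real number $x$ computable if there is a total recursive $f\colon\mathbb{N}^+\to\mathbb{Q}$ with $|x-f(n)|<1/n$ for all $n\in\mathbb{N}^+$; call it left-computable if there is a total recursive $g\colon\mathbb{N}^+\to\mathbb{Q}$ with $g(n)\le x$ for all $n\in\mathbb{N}^+$ and $\lim_{n\to\infty}g(n)=x$. A computer is a partial recursive function $C\colon\{0,1\}^*\to\{0,1\}^*$ whose domain of definition $\operatorname{Dom} C$ is prefix-free. A computer $U$ is optimal if for every computer $C$ there is a constant $\mathrm{sim}(C)$ such that whenever $C(p)$ is defined there is a $p'$ with $U(p')=C(p)$ and $|p'|\le|p|+\mathrm{sim}(C)$. Let $U$ be any optimal computer, let $H(s)=\min\{|p| : U(p)=s\}$ for $s\in\{0,1\}^*$, and let $q_1,q_2,q_3,\dots$ be any enumeration without repetition (not necessarily recursive) of the infinite set $\operatorname{Dom} U$. For a real number $x$, let $x_n$ be the string of the first $n$ bits of the base-two expansion with infinitely many zeros of $x-\lfloor x\rfloor$. For a real number $D\ge 0$, the real $x$ is called Chaitin $D$-random if $\lim_{n\to\infty}\bigl(H(x_n)-Dn\bigr)=\infty$, and $D$-compressible if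 $H(x_n)\le Dn+o(n)$. For $n\in\mathbb{N}^+$ and real $T>0$ put $$Z_n(T)=\sum_{i=1}^n 2^{-|q_i|/T},\qquad E_n(T)=\frac{1}{Z_n(T)}\sum_{i=1}^n|q_i|\,2^{-|q_i|/T},$$ and let $E(T)=\lim_{n\to\infty}E_n(T)$. Theorem. Let $T\in\mathbb{R}$. (i) If $0<T<1$ and $T$ is computable, then $E_n(T)$ converges as $n\to\infty$, and its limit $E(T)$ is a left-computable real number which is Chaitin $T$-random and $T$-compressible. (ii) If $1\le T$, then $E_n(T)$ diverges to $\infty$ as $n\to\infty$. -/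

import Mathlib

open Filter Topology

namespace AIT

/-- A finite binary string. -/
abbrev BinStr : Type := List Bool

/-- A sequence of rationals, indexed by `n`, is recursive: there are total recursive functions
giving a numerator, a nonzero denominator and a sign. -/
def RecursiveRatSeq (f : ℕ → ℚ) : Prop :=
  ∃ a b s : ℕ → ℕ, Computable a ∧ Computable b ∧ Computable s ∧
    ∀ n, b n ≠ 0 ∧ f n = (-1) ^ s n * ((a n : ℚ) / (b n : ℚ))

/-- `x` is a computable real. The sequence is used at positive arguments only. -/
def IsComputableReal (x : ℝ) : Prop :=
  ∃ f : ℕ → ℚ, RecursiveRatSeq f ∧ ∀ n : ℕ, 0 < n → |x - (f n : ℝ)| < 1 / (n : ℝ)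

/-- `x` is a right-computable real: the limit of a recursive sequence of rational upper bounds. -/
def IsRightComputable (x : ℝ) : Prop :=
  ∃ g : ℕ → ℚ, RecursiveRatSeq g ∧ (∀ n : ℕ, 0 < n → x ≤ (g n : ℝ)) ∧
    Tendsto (fun n => (g n : ℝ)) atTop (𝓝 x)

/-- `x` is a left-computable real. -/
def IsLeftComputable (x : ℝ) : Prop := IsRightComputable (-x)

/-- A set of strings is prefix-free: no element is a prefix of another element. -/
def PrefixFree (S : Set BinStr) : Prop :=
  ∀ p ∈ S, ∀ q ∈ S, p <+: q → p = q

/-- A computer: a partial recursive function on strings with prefix-free domain of definition. -/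
def IsComputer (C : BinStr →. BinStr) : Prop :=
  Partrec C ∧ PrefixFree C.Dom

/-- An optimal computer. -/
def IsOptimal (U : BinStr →. BinStr) : Prop :=
  IsComputer U ∧ ∀ C : BinStr →. BinStr, IsComputer C →
    ∃ sim : ℕ, ∀ p s : BinStr, s ∈ C p →
      ∃ p' : BinStr, s ∈ U p' ∧ p'.length ≤ p.length + sim

/-- Program-size complexity of `s` with respect to `U`. For an optimal `U` every string has a
program, so the infimum is a minimum. -/
noncomputable def H (U : BinStr →. BinStr) (s : BinStr) : ℕ :=
  sInf {l : ℕ | ∃ p : BinStr, s ∈ U p ∧ p.length = l}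

/-- The prefix of length `n` of an infinite binary string. -/
def initSeg (α : ℕ → Bool) (n : ℕ) : BinStr := (List.range n).map α

/-- The base-two expansion of the fractional part of `x` with infinitely many zeros
(entry `i` is the bit of weight `2 ^ (-(i + 1))`). -/
noncomputable def binaryExpansion (x : ℝ) : ℕ → Bool :=
  fun i => decide (Real.digits (Int.fract x) 2 i = 1)

/-- `α` is Chaitin `D`-random (with respect to `U`): `H(α_n) - D n → ∞`. -/
def IsChaitinRandom (U : BinStr →. BinStr) (D : ℝ) (α : ℕ → Bool) : Prop :=
  Tendsto (fun n : ℕ => (H U (initSeg α n) : ℝ) - D * (n : ℝ)) atTop atTop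

/-- `α` is `D`-compressible (with respect to `U`): `H(α_n) ≤ D n + o(n)`. -/
def IsCompressible (U : BinStr →. BinStr) (D : ℝ) (α : ℕ → Bool) : Prop :=
  ∃ f : ℕ → ℝ, Tendsto (fun n : ℕ => f n / (n : ℝ)) atTop (𝓝 0) ∧
    ∀ n : ℕ, 0 < n → (H U (initSeg α n) : ℝ) ≤ D * (n : ℝ) + f n

/-- `q` enumerates `S` without repetition (not required to be recursive). -/
def IsEnumeration (q : ℕ → BinStr) (S : Set BinStr) : Prop :=
  Function.Injective q ∧ Set.range q = S

/-- `Z_n(T)`, the sum over the first `n` strings of the enumeration (`q 0, ..., q (n - 1)`). -/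
noncomputable def partialZ (q : ℕ → BinStr) (n : ℕ) (T : ℝ) : ℝ :=
  ∑ i ∈ Finset.range n, (2 : ℝ) ^ (-((q i).length : ℝ) / T)

/-- `E_n(T)`; for `n ≥ 1` the denominator is positive. -/
noncomputable def partialEnergy (q : ℕ → BinStr) (n : ℕ) (T : ℝ) : ℝ :=
  (∑ i ∈ Finset.range n, ((q i).length : ℝ) * (2 : ℝ) ^ (-((q i).length : ℝ) / T)) /
    partialZ q n T

end AIT

/-! Put `y = 2 ^ (-1 / T)`. For `T < 1` one has `y < 1 / 2`, so by Kraft's inequality `W = ∑ |p| y ^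
|p|` and `Z = ∑ y ^ |p|` over the programs converge, unconditionally, and any enumeration gives the
limit `E = W / Z`.

Although `E` is a quotient of two sums that both grow, it can be approximated from below. Over all
programs `∑ (|p| - E) y ^ |p|` vanishes, so for a finite set `F` of programs `E * Z_F - W_F` is the
sum of these terms outside `F`. Once `F` contains all programs shorter than `E`, that sum is
nonnegative and dominates each of its terms. Rounding `W_F` down and `Z_F` up gives the recursive
approximants of `Stages.exists_energy_approx`: their error is at least a constant times `|r| y ^
|r|` for every missing program `r`, and at most a constant times the missing part of `W` plus `2 ^
(-k)`.

Randomness uses the lower error bound. From the first `n` bits of `E` one finds a stage with error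
below `2 * 2 ^ (-n)`, and then a string longer than all outputs of that stage. A program for this
string is missing from the stage, so its length `l` satisfies `l * y ^ l = O(2 ^ (-n))`. The factor
`l` turns this into `l - T n → ∞`, while `l ≤ H(E_n) + O(1)`.

Compressibility uses the upper error bound. For `T < D ≤ 1`, about `D n` bits of `Ω = ∑ 2 ^ (-|p|)`
determine a stage after which only programs of length at least `D n` are missing. Comparison with `2
^ (-|p| / D)` shows that the missing energy is `O(2 ^ (-n))`, so `E_n` is recovered with `O(log n)`
further bits (`IsOptimal.exists_H_le_of_approx`). Then `D` tends to `T`.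

For `T ≥ 1` the numerators diverge, because optimality provides enough programs of near-minimal
length (`IsOptimal.not_summable_lengthWeight`). Only finitely many programs are short, so the mean
length tends to infinity. -/

namespace AIT

/-! ### Closure properties of computable functions and unbounded search -/

section Computability

variable {α β : Type*} [Primcodable α] [Primcodable β]

theorem computable_add {f g : α → ℕ} (hf : Computable f) (hg : Computable g) :
    Computable fun a => f a + g a :=
  Primrec.nat_add.to_comp.comp hf hg

theorem computable_mul {f g : α → ℕ} (hf : Computable f) (hg : Computable g) :
    Computable fun a => f a * g a :=
  Primrec.nat_mul.to_comp.comp hf hg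

theorem computable_sub {f g : α → ℕ} (hf : Computable f) (hg : Computable g) :
    Computable fun a => f a - g a :=
  Primrec.nat_sub.to_comp.comp hf hg

theorem computable_div {f g : α → ℕ} (hf : Computable f) (hg : Computable g) :
    Computable fun a => f a / g a :=
  Primrec.nat_div.to_comp.comp hf hg

theorem computable_pow {f g : α → ℕ} (hf : Computable f) (hg : Computable g) :
    Computable fun a => f a ^ g a :=
  Computable₂.comp (f := fun a b : ℕ => a ^ b)
    (Primrec₂.unpaired'.1 Nat.Primrec.pow).to_comp hf hg

theorem computable_unpair_fst {f : α → ℕ} (hf : Computable f) :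
    Computable fun a => (f a).unpair.1 :=
  Computable.fst.comp (Computable.unpair.comp hf)

theorem computable_unpair_snd {f : α → ℕ} (hf : Computable f) :
    Computable fun a => (f a).unpair.2 :=
  Computable.snd.comp (Computable.unpair.comp hf)

theorem computable_decide_lt {f g : α → ℕ} (hf : Computable f) (hg : Computable g) :
    Computable fun a => decide (f a < g a) :=
  Computable₂.comp (f := fun a b : ℕ => decide (a < b)) Primrec.nat_lt.decide.to_comp hf hg

theorem computable_decide_eq {f g : α → ℕ} (hf : Computable f) (hg : Computable g) :
    Computable fun a => decide (f a = g a) :=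
  Computable₂.comp (f := fun a b : ℕ => decide (a = b)) Primrec.eq.decide.to_comp hf hg

theorem computable_and {f g : α → Bool} (hf : Computable f) (hg : Computable g) :
    Computable fun a => f a && g a :=
  Primrec.and.to_comp.comp hf hg

theorem computable_length {f : α → List β} (hf : Computable f) :
    Computable fun a => (f a).length :=
  Computable.list_length.comp hf

theorem computable_sum_range {f : α → ℕ} {g : α → ℕ → ℕ} (hf : Computable f)
    (hg : Computable₂ g) : Computable fun a => ∑ i ∈ Finset.range (f a), g a i := by
  have h : Computable fun a => Nat.rec (motive := fun _ => ℕ) 0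
      (fun y ih => ih + g a y) (f a) :=
    Computable.nat_rec (h := fun a (p : ℕ × ℕ) => p.2 + g a p.1) hf (Computable.const 0)
      (computable_add (Computable.snd.comp Computable.snd)
        (hg.comp Computable.fst (Computable.fst.comp Computable.snd))).to₂
  refine h.of_eq fun a => ?_
  induction f a with
  | zero => rfl
  | succ n ih => rw [Finset.sum_range_succ, ← ih]

/-- A total unbounded search is computable. -/
theorem exists_computable_search {p : α → ℕ → Bool} (hp : Computable₂ p)
    (h : ∀ a, ∃ n, p a n = true) :
    ∃ f : α → ℕ, Computable f ∧ ∀ a, p a (f a) = true := by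
  have hr : Partrec fun a => Nat.rfind (p a) := Partrec.rfind (p := fun a n => Part.some (p a n)) hp
  have hd : ∀ a, (Nat.rfind (p a)).Dom := fun a =>
    let ⟨n, hn⟩ := h a
    let ⟨m, hm, _⟩ := Nat.rfind_min' hn
    Part.dom_iff_mem.2 ⟨m, hm⟩
  refine ⟨fun a => (Nat.rfind (p a)).get (hd a), ?_, fun a => ?_⟩
  · exact hr.of_eq_tot fun a => Part.get_mem _
  · exact (Part.mem_some_iff.1 (Nat.rfind_spec (Part.get_mem (hd a)))).symm

/-- An unbounded search is partial recursive. -/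
theorem exists_partrec_search {p : α → ℕ → Bool} (hp : Computable₂ p) :
    ∃ f : α →. ℕ, Partrec f ∧ (∀ a, ∀ n ∈ f a, p a n = true) ∧
      ∀ a, (∃ n, p a n = true) → (f a).Dom := by
  refine ⟨fun a => Nat.rfind (p a),
    Partrec.rfind (p := fun a n => Part.some (p a n)) hp, fun a n hn => ?_, fun a ⟨n, hn⟩ => ?_⟩
  · exact (Part.mem_some_iff.1 (Nat.rfind_spec hn)).symm
  · obtain ⟨m, hm, _⟩ := Nat.rfind_min' hn
    exact Part.dom_iff_mem.2 ⟨m, hm⟩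

end Computability

/-! ### Binary strings as numbers -/

/-- The number with the given binary digits, most significant digit first. -/
def val (s : BinStr) : ℕ := s.foldl (fun v b => 2 * v + b.toNat) 0

theorem computable_val : Computable val := by
  refine (Primrec.list_foldl (h := fun (_ : BinStr) (p : ℕ × Bool) => 2 * p.1 + p.2.toNat)
    Primrec.id (Primrec.const 0) ?_).to_comp
  exact Primrec.nat_add.comp
    (Primrec.nat_mul.comp (Primrec.const 2) (Primrec.fst.comp Primrec.snd))
    ((Primrec.dom_bool Bool.toNat).comp (Primrec.snd.comp Primrec.snd))

theorem val_concat (s : BinStr) (b : Bool) : val (s ++ [b]) = 2 * val s + b.toNat := by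
  simp [val]

/-- The `n` least significant binary digits of `m`, most significant digit first. -/
def bits (n m : ℕ) : BinStr := (List.range n).map fun i => decide (m / 2 ^ (n - 1 - i) % 2 = 1)

theorem length_bits (n m : ℕ) : (bits n m).length = n := by simp [bits]

theorem bits_succ (n m : ℕ) : bits (n + 1) m = bits n (m / 2) ++ [decide (m % 2 = 1)] := by
  simp only [bits, List.range_succ, List.map_append, List.map_cons, List.map_nil]
  congr 1
  · refine List.map_congr_left fun i hi => ?_
    have hi := List.mem_range.1 hi
    rw [Nat.div_div_eq_div_mul, ← pow_succ']
    congr 5; omega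
  · simp

theorem val_bits (n m : ℕ) : val (bits n m) = m % 2 ^ n := by
  induction n generalizing m with
  | zero => simp [bits, val, Nat.mod_one]
  | succ n ih =>
    rw [bits_succ, val_concat, ih, pow_succ', Nat.mod_mul]
    rcases Nat.mod_two_eq_zero_or_one m with h | h <;> simp [h]; ring

theorem computable_bits {α : Type*} [Primcodable α] {f g : α → ℕ} (hf : Computable f)
    (hg : Computable g) : Computable fun a => bits (f a) (g a) := by
  have hb : Primrec₂ bits := by
    refine Primrec.list_map (f := fun p : ℕ × ℕ => List.range p.1)
      (g := fun (p : ℕ × ℕ) i => decide (p.2 / 2 ^ (p.1 - 1 - i) % 2 = 1))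
      (Primrec.list_range.comp Primrec.fst) ?_
    refine Primrec₂.comp (f := fun a b : ℕ => decide (a = b)) Primrec.eq.decide ?_ (Primrec.const 1)
    refine Primrec.nat_mod.comp (Primrec.nat_div.comp (Primrec.snd.comp Primrec.fst) ?_)
      (Primrec.const 2)
    refine Primrec₂.comp (f := fun a b : ℕ => a ^ b)
      (Primrec₂.unpaired'.1 Nat.Primrec.pow) (Primrec.const 2) ?_
    exact Primrec.nat_sub.comp
      (Primrec.nat_sub.comp (Primrec.fst.comp Primrec.fst) (Primrec.const 1)) Primrec.snd
  exact hb.to_comp.comp hf hg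

/-! ### Finite stages of the domain -/

/-- The domain of a partial recursive function on strings is exhausted by an increasing sequence of
finite sets over which sums of computable functions are computable. -/
structure Stages (U : BinStr →. BinStr) where
  set : ℕ → Finset BinStr
  mono : Monotone set
  mem_dom : ∀ p, p ∈ U.Dom ↔ ∃ k, p ∈ set k
  length_le : ∀ {k p}, p ∈ set k → p.length ≤ k
  card_le : ∀ k, (set k).card ≤ k
  computable_sum : ∀ {f : ℕ → BinStr → ℕ}, Computable₂ f → Computable fun k => ∑ p ∈ set k, f k p
  bound : ℕ → ℕ
  computable_bound : Computable bound
  length_lt_bound : ∀ {k p s}, p ∈ set k → s ∈ U p → s.length < bound k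

/-- Stage `k` consists of the strings with code below `k` on which `evaln k` halts. Codes dominate
lengths, which gives the size bounds. A sum over a stage is a sum over all codes below `k`, where
non-codes and non-halting inputs contribute `0`. -/
theorem nonempty_stages {U : BinStr →. BinStr} (hU : Partrec U) : Nonempty (Stages U) := by
  obtain ⟨c, hc⟩ := Nat.Partrec.Code.exists_code.1 hU
  have hev : ∀ p, c.eval (Encodable.encode p) = (U p).map Encodable.encode := by
    intro p; rw [hc]; simp
  let S : ℕ → Finset BinStr := fun k =>
    ((Finset.range k).preimage Encodable.encode Encodable.encode_injective.injOn).filter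
      fun p => (c.evaln k (Encodable.encode p)).isSome
  have hS : ∀ k p, p ∈ S k ↔ Encodable.encode p < k ∧ (c.evaln k (Encodable.encode p)).isSome := by
    intro k p; simp [S]
  have hev2 : ∀ k p v, v ∈ c.evaln k (Encodable.encode p) → ∃ s ∈ U p, Encodable.encode s = v := by
    intro k p v hv
    have := Nat.Partrec.Code.evaln_sound hv
    rw [hev, Part.mem_map_iff] at this
    exact this
  have hcev : Computable₂ fun k n => c.evaln k n :=
    Nat.Partrec.Code.primrec_evaln.to_comp.comp
      ((Computable.fst.pair (Computable.const c)).pair Computable.snd)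
  -- The code of an output at stage `k` is one of these summands and is at least the length of that
  -- output.
  refine ⟨⟨S, ?_, ?_, ?_, ?_, ?_, fun k => 1 + ∑ n ∈ Finset.range k, (c.evaln k n).getD 0, ?_, ?_⟩⟩
  · intro k l hkl p hp
    rw [hS] at hp ⊢
    obtain ⟨h1, h2⟩ := hp
    obtain ⟨v, hv⟩ := Option.isSome_iff_exists.1 h2
    exact ⟨h1.trans_le hkl, Option.isSome_iff_exists.2 ⟨v, Nat.Partrec.Code.evaln_mono hkl hv⟩⟩
  · intro p
    constructor
    · intro hp
      obtain ⟨s, hs⟩ := Part.dom_iff_mem.1 hp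
      have : Encodable.encode s ∈ c.eval (Encodable.encode p) := by
        rw [hev]; exact Part.mem_map _ hs
      obtain ⟨k, hk⟩ := Nat.Partrec.Code.evaln_complete.1 this
      exact ⟨k, (hS k p).2 ⟨Nat.Partrec.Code.evaln_bound hk, Option.isSome_iff_exists.2 ⟨_, hk⟩⟩⟩
    · rintro ⟨k, hk⟩
      obtain ⟨v, hv⟩ := Option.isSome_iff_exists.1 ((hS k p).1 hk).2
      obtain ⟨s, hs, -⟩ := hev2 k p v hv
      exact Part.dom_iff_mem.2 ⟨s, hs⟩
  · intro k p hp
    exact (Encodable.length_le_encode p).trans ((hS k p).1 hp).1.le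
  · intro k
    have : ((S k).image Encodable.encode) ⊆ Finset.range k := by
      intro n hn
      obtain ⟨p, hp, rfl⟩ := Finset.mem_image.1 hn
      exact Finset.mem_range.2 ((hS k p).1 hp).1
    calc (S k).card = ((S k).image Encodable.encode).card :=
          (Finset.card_image_of_injective _ Encodable.encode_injective).symm
      _ ≤ k := by simpa using Finset.card_le_card this
  · intro f hf
    let t : ℕ → ℕ → ℕ := fun k n =>
      ((Encodable.decode₂ BinStr n).map fun p => bif (c.evaln k n).isSome then f k p else 0).getD 0
    have ht : Computable₂ t := by
      refine Computable.option_getD (f := fun a : ℕ × ℕ => (Encodable.decode₂ BinStr a.2).map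
        fun p => bif (c.evaln a.1 a.2).isSome then f a.1 p else 0) ?_ (Computable.const 0)
      refine Computable.option_map (f := fun a : ℕ × ℕ => Encodable.decode₂ BinStr a.2)
        (Primrec.decode₂.to_comp.comp Computable.snd) ?_
      refine Computable.cond (c := fun a : (ℕ × ℕ) × BinStr => (c.evaln a.1.1 a.1.2).isSome) ?_ ?_
        (Computable.const 0)
      · exact Primrec.option_isSome.to_comp.comp
          (hcev.comp (Computable.fst.comp Computable.fst) (Computable.snd.comp Computable.fst))
      · exact hf.comp (Computable.fst.comp Computable.fst) Computable.snd
    refine (computable_sum_range Computable.id ht).of_eq fun k => ?_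
    have h1 := Finset.sum_preimage (Encodable.encode : BinStr → ℕ) (Finset.range k)
      Encodable.encode_injective.injOn (t k) (by
        intro n _ hn
        have : Encodable.decode₂ BinStr n = none := by
          by_contra h
          obtain ⟨p, hp⟩ := Option.ne_none_iff_exists'.1 h
          exact hn ⟨p, Encodable.mem_decode₂.1 hp⟩
        simp [t, this])
    simp only [id]
    rw [← h1, Finset.sum_filter]
    refine Finset.sum_congr rfl fun p _ => ?_
    simp only [t, Encodable.encodek₂, Option.map_some, Option.getD_some]
    cases (c.evaln k (Encodable.encode p)).isSome <;> simp
  · refine computable_add (Computable.const 1) (computable_sum_range Computable.id ?_)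
    exact Computable.option_getD (f := fun a : ℕ × ℕ => c.evaln a.1 a.2) hcev (Computable.const 0)
  · intro k p s hp hs
    obtain ⟨h1, h2⟩ := (hS k p).1 hp
    obtain ⟨v, hv⟩ := Option.isSome_iff_exists.1 h2
    obtain ⟨s', hs', rfl⟩ := hev2 k p v hv
    obtain rfl := Part.mem_unique hs hs'
    have h3 := Finset.single_le_sum (f := fun n => (c.evaln k n).getD 0)
      (fun _ _ => Nat.zero_le _) (Finset.mem_range.2 h1)
    simp only [hv, Option.getD_some] at h3
    have := Encodable.length_le_encode s
    omega

/-! ### Upper bounds on program size from optimality -/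

section Programs

variable {U : BinStr →. BinStr}

theorem H_le_length {s p : BinStr} (h : s ∈ U p) : H U s ≤ p.length :=
  Nat.sInf_le ⟨p, h, rfl⟩

/-- A string is encoded as `1 ^ k 0 a w`, where `|a| = k` and `|w|` is determined by `a`. -/
theorem IsOptimal.exists_program_le (hU : IsOptimal U) {G : BinStr → ℕ} (hG : Computable G)
    {F : BinStr × BinStr →. BinStr} (hF : Partrec F) :
    ∃ c : ℕ, ∀ a w s : BinStr, w.length = G a → s ∈ F (a, w) →
      ∃ p, s ∈ U p ∧ p.length ≤ 2 * a.length + w.length + c := by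
  let k : BinStr → ℕ := fun x => (x.takeWhile id).length
  let a : BinStr → BinStr := fun x => (x.drop (k x + 1)).take (k x)
  let w : BinStr → BinStr := fun x => x.drop (2 * k x + 1)
  have hk : Computable k := computable_length (Primrec.list_takeWhile Primrec.id).to_comp
  have ha : Computable a := Primrec.list_take.to_comp.comp hk
    (Primrec.list_drop.to_comp.comp (computable_add hk (Computable.const 1)) Computable.id)
  have hw : Computable w := Primrec.list_drop.to_comp.comp
    (computable_add (computable_mul (Computable.const 2) hk) (Computable.const 1)) Computable.id
  let C : BinStr →. BinStr := fun x =>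
    bif decide (x.length = 2 * k x + 1 + G (a x)) then F (a x, w x) else Part.none
  have hC : Partrec C := by
    refine Partrec.cond (computable_decide_eq Computable.list_length ?_)
      (hF.comp (ha.pair hw)) Partrec.none
    exact computable_add (computable_add (computable_mul (Computable.const 2) hk)
      (Computable.const 1)) (hG.comp ha)
  have hdom : ∀ x, x ∈ C.Dom → x.length = 2 * k x + 1 + G (a x) := by
    intro x hx
    by_contra h
    have : ¬ (C x).Dom := by simp [C, h]
    exact this hx
  have hpf : PrefixFree C.Dom := by
    intro x hx y hy hxy
    have h1 := hdom x hx
    have h2 := hdom y hy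
    obtain ⟨z, rfl⟩ := hxy
    have hkz : k (x ++ z) = k x := by
      simp only [k]
      -- The initial run of ones ends inside `x`: otherwise `k x` would equal the length of `x`,
      -- against the length equation `h1`.
      rw [List.takeWhile_append, if_neg]
      intro h
      change k x = _ at h
      omega
    have haz : a (x ++ z) = a x := by
      simp only [a]
      rw [hkz, List.drop_append_of_le_length (by omega), List.take_append_of_le_length]
      rw [List.length_drop]; omega
    rw [hkz, haz, List.length_append] at h2
    have : z = [] := List.length_eq_zero_iff.1 (by omega)
    simp [this]
  obtain ⟨c, hc⟩ := hU.2 C ⟨hC, hpf⟩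
  refine ⟨c + 1, fun a' w' s hw' hs => ?_⟩
  let x : BinStr := List.replicate a'.length true ++ false :: (a' ++ w')
  have hkx : k x = a'.length := by
    simp only [k, x]
    rw [List.takeWhile_append_of_pos (by simp)]
    simp
  have hax : a x = a' := by
    simp only [a, hkx]
    rw [List.drop_append, List.drop_eq_nil_of_le (by simp)]
    simp
  have hwx : w x = w' := by
    simp only [w, hkx]
    have : x = (List.replicate a'.length true ++ false :: a') ++ w' := by simp [x]
    rw [this, List.drop_left' (by simp; omega)]
  have hlx : x.length = 2 * a'.length + 1 + w'.length := by
    simp only [x, List.length_append, List.length_replicate, List.length_cons]; omega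
  have hsx : s ∈ C x := by
    simp only [C, hkx, hax, hwx, hlx, hw']
    simpa using hs
  obtain ⟨p, hp, hpl⟩ := hc x s hsx
  exact ⟨p, hp, by omega⟩

theorem IsOptimal.exists_program (hU : IsOptimal U) (s : BinStr) :
    ∃ p, s ∈ U p ∧ p.length = H U s := by
  obtain ⟨c, hc⟩ := hU.exists_program_le (Computable.const 0)
    (F := fun _ => Part.some s) (Computable.const s)
  obtain ⟨p, hp, -⟩ := hc [] [] s rfl (Part.mem_some s)
  exact Nat.sInf_mem (s := {l : ℕ | ∃ p : BinStr, s ∈ U p ∧ p.length = l}) ⟨p.length, p, hp, rfl⟩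

/-- Running `U` and then `φ` is again a computer, since its domain lies inside the prefix-free
domain of `U`. -/
theorem IsOptimal.exists_program_le_H_add (hU : IsOptimal U) {φ : BinStr →. BinStr}
    (hφ : Partrec φ) :
    ∃ c : ℕ, ∀ s, ∀ t ∈ φ s, ∃ p, t ∈ U p ∧ p.length ≤ H U s + c := by
  let C : BinStr →. BinStr := fun p => (U p).bind φ
  have hC : Partrec C := hU.1.1.bind (hφ.comp Computable.snd).to₂
  have hpf : PrefixFree C.Dom := by
    intro x hx y hy
    exact hU.1.2 x (Part.Dom.of_bind hx) y (Part.Dom.of_bind hy)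
  obtain ⟨c, hc⟩ := hU.2 C ⟨hC, hpf⟩
  refine ⟨c, fun s t ht => ?_⟩
  obtain ⟨p, hp, hpl⟩ := hU.exists_program s
  obtain ⟨p', hp', hpl'⟩ := hc p t (Part.mem_bind hp ht)
  exact ⟨p', hp', by omega⟩

end Programs

/-! ### Effective approximation of `T` and of `2 ^ (-1 / T)` -/

/-- Starting the sequence beyond `1 / T` makes every error smaller than `T`; the approximants are
then positive and their signs can be dropped. -/
theorem IsComputableReal.exists_nat_approx {T : ℝ} (hT : 0 < T) (h : IsComputableReal T) :
    ∃ a b : ℕ → ℕ, Computable a ∧ Computable b ∧ (∀ j, 0 < b j) ∧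
      ∀ j : ℕ, |T - (a j : ℝ) / b j| < 1 / ((j : ℝ) + 1) := by
  obtain ⟨f, ⟨a, b, s, ha, hb, hs, hf⟩, hfT⟩ := h
  obtain ⟨j0, hj0⟩ := exists_nat_gt (1 / T)
  have hj0' : (0 : ℝ) < j0 := (by positivity : (0:ℝ) < 1 / T).trans hj0
  have hshift : Computable fun j : ℕ => j + (j0 + 1) :=
    computable_add Computable.id (Computable.const _)
  refine ⟨fun j => a (j + (j0 + 1)), fun j => b (j + (j0 + 1)), ha.comp hshift, hb.comp hshift,
    fun j => Nat.pos_of_ne_zero (hf _).1, fun j => ?_⟩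
  set n := j + (j0 + 1) with hn
  have hnr : (n : ℝ) = j + j0 + 1 := by rw [hn]; push_cast; ring
  have h1 := hfT n (by omega)
  have hj : (0 : ℝ) ≤ j := Nat.cast_nonneg j
  have hle : 1 / (n : ℝ) ≤ 1 / ((j : ℝ) + 1) :=
    one_div_le_one_div_of_le (by positivity) (by rw [hnr]; linarith)
  have hlt : 1 / (n : ℝ) < T := by
    rw [div_lt_iff₀ (by rw [hnr]; positivity), hnr]
    rw [div_lt_iff₀ hT] at hj0
    nlinarith
  have hpos : 0 < (f n : ℝ) := by
    have := (abs_lt.1 h1).2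
    linarith
  have hfn : (f n : ℝ) = (a n : ℝ) / b n := by
    have h2 := (hf n).2
    rcases neg_one_pow_eq_or ℚ (s n) with h3 | h3
    · rw [h2, h3]; push_cast; ring
    · exfalso
      rw [h2, h3] at hpos
      push_cast at hpos
      have : (0 : ℝ) ≤ (a n : ℝ) / b n := by positivity
      linarith
  rw [← hfn]
  exact h1.trans_le hle

theorem two_rpow_neg_one_div_le_half {T : ℝ} (hT : 0 < T) (hT1 : T ≤ 1) :
    (2 : ℝ) ^ (-1 / T) ≤ 1 / 2 := by
  have h : (2 : ℝ) ^ (-1 / T) ≤ 2 ^ (-1 : ℝ) := by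
    apply Real.rpow_le_rpow_of_exponent_le one_le_two
    rw [div_le_iff₀ hT]; linarith
  rwa [Real.rpow_neg_one, ← one_div] at h

theorem two_rpow_neg_one_div_lt_half {T : ℝ} (hT : 0 < T) (hT1 : T < 1) :
    (2 : ℝ) ^ (-1 / T) < 1 / 2 := by
  have h : (2 : ℝ) ^ (-1 / T) < 2 ^ (-1 : ℝ) := by
    apply Real.rpow_lt_rpow_of_exponent_lt one_lt_two
    rw [div_lt_iff₀ hT]; linarith
  rwa [Real.rpow_neg_one, ← one_div] at h

/-- For rationals `u / v < T < u' / v`, the inequality `p / 2 ^ n < 2 ^ (-v / u)` certifies `p < 2 ^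
n * y`, and `(p + 2) / 2 ^ n > 2 ^ (-v / u')` certifies the upper bound. Both become inequalities
between natural numbers after clearing exponents, so one can search for `p` together with a
precision `j`. -/
theorem exists_dyadic_approx {T : ℝ} (hT : 0 < T) (h : IsComputableReal T) :
    ∃ P : ℕ → ℕ, Computable P ∧ ∀ n : ℕ, (P n : ℝ) < 2 ^ n * (2 : ℝ) ^ (-1 / T) ∧
      2 ^ n * (2 : ℝ) ^ (-1 / T) < P n + 2 := by
  obtain ⟨a, b, ha, hb, hb0, hab⟩ := h.exists_nat_approx hT
  set y : ℝ := (2 : ℝ) ^ (-1 / T) with hy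
  have hy0 : 0 < y := by positivity
  have hlog2 : 0 < Real.log 2 := Real.log_pos one_lt_two
  have hlogy : Real.log y * T = -Real.log 2 := by
    rw [hy, Real.log_rpow two_pos]; field_simp
  let u : ℕ → ℕ := fun j => a j * (j + 1) - b j
  let u' : ℕ → ℕ := fun j => a j * (j + 1) + b j
  let v : ℕ → ℕ := fun j => b j * (j + 1)
  have hj1 : Computable fun j : ℕ => j + 1 := computable_add Computable.id (Computable.const 1)
  have hu : Computable u := computable_sub (computable_mul ha hj1) hb
  have hu' : Computable u' := computable_add (computable_mul ha hj1) hb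
  have hv : Computable v := computable_mul hb hj1
  have hvr : ∀ j, (v j : ℝ) = b j * (j + 1) := by intro j; simp [v]
  have hv0 : ∀ j, (0 : ℝ) < v j := fun j => by
    rw [hvr]; have := hb0 j; positivity
  have hbounds : ∀ j, (v j : ℝ) * (T - 2 / (j + 1)) ≤ u j ∧ (u j : ℝ) < v j * T ∧
      (v j : ℝ) * T < u' j ∧ (u' j : ℝ) ≤ v j * (T + 2 / (j + 1)) := by
    intro j
    have hbj : (0 : ℝ) < b j := by exact_mod_cast hb0 j
    have hj : (0 : ℝ) < (j : ℝ) + 1 := by positivity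
    obtain ⟨h1, h2⟩ := abs_lt.1 (hab j)
    have e1 : (v j : ℝ) * (2 / (j + 1)) = 2 * b j := by rw [hvr]; field_simp
    have e2 : (v j : ℝ) * (1 / (j + 1)) = b j := by rw [hvr]; field_simp
    have e3 : (v j : ℝ) * (a j / b j) = a j * (j + 1) := by rw [hvr]; field_simp
    have g1 := mul_lt_mul_of_pos_left h1 (hv0 j)
    have g2 := mul_lt_mul_of_pos_left h2 (hv0 j)
    have hu'r : (u' j : ℝ) = a j * (j + 1) + b j := by simp [u']
    have hur : (a j : ℝ) * (j + 1) - b j ≤ u j := by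
      have : a j * (j + 1) ≤ u j + b j := by simp only [u]; omega
      have : (a j : ℝ) * (j + 1) ≤ u j + b j := by exact_mod_cast this
      linarith
    have hur2 : (u j : ℝ) < v j * T := by
      rcases le_total (a j * (j + 1)) (b j) with hle | hle
      · have : u j = 0 := by simp only [u]; omega
        rw [this]; push_cast
        have := hv0 j
        positivity
      · have : u j + b j = a j * (j + 1) := by simp only [u]; omega
        have : (u j : ℝ) + b j = a j * (j + 1) := by exact_mod_cast this
        nlinarith
    refine ⟨?_, hur2, ?_, ?_⟩ <;> nlinarith
  have hpow : ∀ n m : ℕ, ∀ r : ℝ, 0 < r → r ^ n * 2 ^ m = Real.exp (n * Real.log r + m * Real.log 2) := by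
    intro n m r hr
    rw [Real.exp_add, mul_comm (n : ℝ), mul_comm (m : ℝ), ← Real.rpow_def_of_pos hr,
      ← Real.rpow_def_of_pos two_pos, Real.rpow_natCast, Real.rpow_natCast]
  let pr : ℕ → ℕ → Bool := fun n m =>
    decide (m.unpair.1 ^ u m.unpair.2 * 2 ^ v m.unpair.2 < 2 ^ (n * u m.unpair.2)) &&
    decide (2 ^ (n * u' m.unpair.2) < (m.unpair.1 + 2) ^ u' m.unpair.2 * 2 ^ v m.unpair.2)
  have hpr : Computable₂ pr := by
    have c1 : Computable fun x : ℕ × ℕ => x.2.unpair.1 := computable_unpair_fst Computable.snd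
    have c2 : Computable fun x : ℕ × ℕ => x.2.unpair.2 := computable_unpair_snd Computable.snd
    have k2 : Computable fun _ : ℕ × ℕ => 2 := Computable.const 2
    exact computable_and
      (computable_decide_lt (computable_mul (computable_pow c1 (hu.comp c2))
        (computable_pow k2 (hv.comp c2)))
        (computable_pow k2 (computable_mul Computable.fst (hu.comp c2))))
      (computable_decide_lt (computable_pow k2 (computable_mul Computable.fst (hu'.comp c2)))
        (computable_mul (computable_pow (computable_add c1 k2) (hu'.comp c2))
        (computable_pow k2 (hv.comp c2))))
  have hsound : ∀ n m, pr n m = true → (m.unpair.1 : ℝ) < 2 ^ n * y ∧ 2 ^ n * y < m.unpair.1 + 2 := by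
    intro n m hm
    simp only [pr, Bool.and_eq_true, decide_eq_true_eq] at hm
    generalize m.unpair.1 = p at *
    generalize m.unpair.2 = j at *
    obtain ⟨h1, h2⟩ := hm
    have h1' : (p : ℝ) ^ u j * 2 ^ v j < 2 ^ (n * u j) := by exact_mod_cast h1
    have h2' : (2 : ℝ) ^ (n * u' j) < (p + 2) ^ u' j * 2 ^ v j := by exact_mod_cast h2
    obtain ⟨-, b2, b3, -⟩ := hbounds j
    have key : ∀ x : ℝ, x * Real.log y * T = -(x * Real.log 2) := by
      intro x; rw [mul_assoc, hlogy]; ring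
    constructor
    · by_contra! hle
      have g1 : (2 ^ n * y) ^ u j * 2 ^ v j ≤ (p : ℝ) ^ u j * 2 ^ v j := by gcongr
      rw [mul_pow, ← pow_mul, mul_assoc] at g1
      have g2 : 1 ≤ y ^ u j * 2 ^ v j := by
        rw [hpow _ _ _ hy0]
        apply Real.one_le_exp
        have := key (u j)
        by_contra! hneg
        nlinarith
      have : (2 : ℝ) ^ (n * u j) ≤ 2 ^ (n * u j) * (y ^ u j * 2 ^ v j) :=
        le_mul_of_one_le_right (by positivity) g2
      linarith
    · by_contra! hle
      have g1 : (p + 2 : ℝ) ^ u' j * 2 ^ v j ≤ (2 ^ n * y) ^ u' j * 2 ^ v j := by gcongr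
      rw [mul_pow, ← pow_mul, mul_assoc] at g1
      have g2 : y ^ u' j * 2 ^ v j ≤ 1 := by
        rw [hpow _ _ _ hy0]
        apply Real.exp_le_one_iff.2
        have := key (u' j)
        by_contra! hneg
        nlinarith
      have : (2 : ℝ) ^ (n * u' j) * (y ^ u' j * 2 ^ v j) ≤ 2 ^ (n * u' j) :=
        mul_le_of_le_one_right (by positivity) g2
      linarith
  have hex : ∀ n, ∃ m, pr n m = true := by
    intro n
    -- With `p < 2 ^ n * y ≤ p + 1`, both target inequalities are strict, even if `2 ^ n * y` is an
    -- integer. This slack is why the width is `2`: a large `j` then certifies both.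
    have hc0 : 0 < ⌈2 ^ n * y⌉₊ := Nat.ceil_pos.2 (by positivity)
    obtain ⟨p, hp⟩ : ∃ p, ⌈2 ^ n * y⌉₊ = p + 1 := ⟨_, (Nat.succ_pred_eq_of_pos hc0).symm⟩
    have hp1 : (p : ℝ) < 2 ^ n * y := Nat.lt_ceil.1 (by omega)
    have hp2 : 2 ^ n * y < p + 2 := by
      have := Nat.le_ceil (2 ^ n * y)
      rw [hp] at this; push_cast at this; linarith
    have h2n : (0 : ℝ) < 2 ^ n := by positivity
    -- The lower cut-off keeps `r` positive when `p = 0`, so that logarithms apply.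
    set r : ℝ := max (p / 2 ^ n) (y / 2) with hr
    have hr0 : 0 < r := lt_max_of_lt_right (by positivity)
    have hry : r < y := max_lt (by rw [div_lt_iff₀ h2n]; linarith) (by linarith)
    have hrp : (p : ℝ) ≤ 2 ^ n * r := by
      have := le_max_left ((p : ℝ) / 2 ^ n) (y / 2)
      rw [← hr, div_le_iff₀ h2n] at this; linarith
    set r' : ℝ := (p + 2) / 2 ^ n with hr'
    have hry' : y < r' := by rw [hr', lt_div_iff₀ h2n]; linarith
    have hr'0 : 0 < r' := hy0.trans hry'
    have hrp' : 2 ^ n * r' = p + 2 := by rw [hr']; field_simp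
    have hl : Real.log 2 < -Real.log r * T := by
      have := Real.log_lt_log hr0 hry; nlinarith
    have hl' : max (-Real.log r') 0 * T < Real.log 2 := by
      rcases max_cases (-Real.log r') 0 with ⟨e, -⟩ | ⟨e, -⟩ <;> rw [e]
      · have := Real.log_lt_log hy0 hry'; nlinarith
      · simpa using hlog2
    have htend : Tendsto (fun j : ℕ => 2 / ((j : ℝ) + 1)) atTop (𝓝 0) := by
      have := (tendsto_one_div_add_atTop_nhds_zero_nat (𝕜 := ℝ)).const_mul 2
      simpa [div_eq_mul_inv] using this
    have t1 : ∀ᶠ j : ℕ in atTop, Real.log 2 < -Real.log r * (T - 2 / (j + 1)) := by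
      have : Tendsto (fun j : ℕ => -Real.log r * (T - 2 / ((j : ℝ) + 1))) atTop
          (𝓝 (-Real.log r * (T - 0))) := (htend.const_sub T).const_mul _
      exact this.eventually_const_lt (by simpa using hl)
    have t2 : ∀ᶠ j : ℕ in atTop, max (-Real.log r') 0 * (T + 2 / (j + 1)) < Real.log 2 := by
      have : Tendsto (fun j : ℕ => max (-Real.log r') 0 * (T + 2 / ((j : ℝ) + 1))) atTop
          (𝓝 (max (-Real.log r') 0 * (T + 0))) := (htend.const_add T).const_mul _
      exact this.eventually_lt_const (by simpa using hl')
    obtain ⟨j, h1, h2⟩ := (t1.and t2).exists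
    obtain ⟨b1, -, -, b4⟩ := hbounds j
    refine ⟨Nat.pair p j, ?_⟩
    simp only [pr, Nat.unpair_pair, Bool.and_eq_true, decide_eq_true_eq]
    have hlr : 0 < -Real.log r := by
      by_contra! hneg
      nlinarith
    constructor
    · have g2 : r ^ u j * 2 ^ v j < 1 := by
        rw [hpow _ _ _ hr0, Real.exp_lt_one_iff]
        have := mul_le_mul_of_nonneg_left b1 hlr.le
        have := mul_lt_mul_of_pos_left h1 (hv0 j)
        nlinarith
      have g1 : (p : ℝ) ^ u j * 2 ^ v j ≤ (2 ^ n * r) ^ u j * 2 ^ v j := by gcongr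
      rw [mul_pow, ← pow_mul, mul_assoc] at g1
      have : (2 : ℝ) ^ (n * u j) * (r ^ u j * 2 ^ v j) < 2 ^ (n * u j) :=
        mul_lt_of_lt_one_right (by positivity) g2
      exact_mod_cast g1.trans_lt this
    · have g2 : 1 < r' ^ u' j * 2 ^ v j := by
        rw [hpow _ _ _ hr'0, Real.one_lt_exp_iff]
        have := mul_le_mul_of_nonneg_left b4 (le_max_right (-Real.log r') 0)
        have := mul_lt_mul_of_pos_left h2 (hv0 j)
        have := mul_le_mul_of_nonneg_right (le_max_left (-Real.log r') 0) (Nat.cast_nonneg (α := ℝ) (u' j))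
        nlinarith
      have g1 : (2 : ℝ) ^ (n * u' j) < 2 ^ (n * u' j) * (r' ^ u' j * 2 ^ v j) :=
        lt_mul_of_one_lt_right (by positivity) g2
      rw [← mul_assoc, pow_mul, ← mul_pow, hrp', ← pow_mul] at g1
      exact_mod_cast g1
  obtain ⟨f, hf, hpf⟩ := exists_computable_search hpr hex
  exact ⟨fun n => (f n).unpair.1, computable_unpair_fst hf, fun n => hsound n _ (hpf n)⟩

/-! ### Limits along the stages -/

theorem Stages.exists_forall_mem {U : BinStr →. BinStr} (S : Stages U) (F : Finset BinStr) :
    ∃ k₀, ∀ k ≥ k₀, ∀ p ∈ F, p ∈ U.Dom → p ∈ S.set k := by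
  classical
  induction F using Finset.induction_on with
  | empty => exact ⟨0, by simp⟩
  | insert p F _ ih =>
    obtain ⟨k₀, hk₀⟩ := ih
    by_cases hp : p ∈ U.Dom
    · obtain ⟨k₁, hk₁⟩ := (S.mem_dom p).1 hp
      refine ⟨max k₀ k₁, fun k hk r hr hrd => ?_⟩
      rcases Finset.mem_insert.1 hr with rfl | hr
      · exact S.mono ((le_max_right _ _).trans hk) hk₁
      · exact hk₀ k ((le_max_left _ _).trans hk) r hr hrd
    · refine ⟨k₀, fun k hk r hr hrd => ?_⟩
      rcases Finset.mem_insert.1 hr with rfl | hr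
      · exact absurd hrd hp
      · exact hk₀ k hk r hr hrd

theorem Stages.exists_forall_length_lt {U : BinStr →. BinStr} (S : Stages U) (n : ℕ) :
    ∃ k₀, ∀ k ≥ k₀, ∀ p ∈ U.Dom, p ∉ S.set k → n ≤ p.length := by
  obtain ⟨k₀, hk₀⟩ := S.exists_forall_mem (List.finite_length_lt Bool n).toFinset
  refine ⟨k₀, fun k hk p hp hpk => ?_⟩
  by_contra! h
  exact hpk (hk₀ k hk p (by simpa using h) hp)

theorem Stages.tendsto_sum {U : BinStr →. BinStr} (S : Stages U) {f : BinStr → ℝ}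
    (hf : Summable f) (hfs : ∀ p, p ∉ U.Dom → f p = 0) :
    Tendsto (fun k => ∑ p ∈ S.set k, f p) atTop (𝓝 (∑' p, f p)) := by
  classical
  rw [Metric.tendsto_atTop]
  intro ε hε
  obtain ⟨F, hF⟩ := Metric.tendsto_atTop.1 hf.hasSum ε hε
  obtain ⟨k₀, hk₀⟩ := S.exists_forall_mem F
  refine ⟨k₀, fun k hk => ?_⟩
  have h : ∑ p ∈ S.set k, f p = ∑ p ∈ F ∪ S.set k, f p := by
    refine Finset.sum_subset Finset.subset_union_right fun p hp hpk => hfs p fun hpd => hpk ?_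
    rcases Finset.mem_union.1 hp with h | h
    · exact hk₀ k hk p h hpd
    · exact h
  rw [h]
  exact hF _ Finset.subset_union_left

/-! ### Kraft's inequality -/

theorem PrefixFree.uniquelyDecodable {S : Set BinStr} (hS : PrefixFree S) (h0 : [] ∉ S) :
    InformationTheory.UniquelyDecodable S := by
  intro L₁
  induction L₁ with
  | nil =>
    rintro (_ | ⟨w, L₂⟩) _ h₂ h
    · rfl
    · simp only [List.flatten_nil, List.flatten_cons, List.nil_eq, List.append_eq_nil_iff] at h
      exact absurd (h.1 ▸ h₂ w (by simp)) h0
  | cons v L₁ ih =>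
    rintro (_ | ⟨w, L₂⟩) h₁ h₂ h
    · simp only [List.flatten_nil, List.flatten_cons, List.append_eq_nil_iff] at h
      exact absurd (h.1 ▸ h₁ v (by simp)) h0
    · simp only [List.flatten_cons] at h
      have hv := h₁ v (by simp)
      have hw := h₂ w (by simp)
      have hvw : v = w := by
        rcases List.prefix_or_prefix_of_prefix (List.prefix_append v L₁.flatten)
          (h ▸ List.prefix_append w L₂.flatten) with h' | h'
        · exact hS v hv w hw h'
        · exact (hS w hw v hv h').symm
      subst hvw
      rw [ih L₂ (fun x hx => h₁ x (List.mem_cons_of_mem _ hx))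
        (fun x hx => h₂ x (List.mem_cons_of_mem _ hx)) (List.append_cancel_left h)]

theorem PrefixFree.sum_le_one {S : Set BinStr} (hS : PrefixFree S) (h0 : [] ∉ S)
    (F : Finset BinStr) (hF : ∀ p ∈ F, p ∈ S) : ∑ p ∈ F, (1 / 2 : ℝ) ^ p.length ≤ 1 := by
  have h : InformationTheory.UniquelyDecodable (F : Set BinStr) := fun L₁ L₂ h₁ h₂ =>
    hS.uniquelyDecodable h0 L₁ L₂ (fun w hw => hF w (h₁ w hw)) (fun w hw => hF w (h₂ w hw))
  simpa using InformationTheory.kraft_mcmillan_inequality h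

/-! ### Weighted sums over programs and their tails -/

/-- The weight `y ^ |p|` on the programs `p` for `U`. -/
noncomputable def weight (U : BinStr →. BinStr) (y : ℝ) : BinStr → ℝ :=
  U.Dom.indicator fun p => y ^ p.length

/-- The weight `|p| y ^ |p|` on the programs `p` for `U`. -/
noncomputable def lengthWeight (U : BinStr →. BinStr) (y : ℝ) : BinStr → ℝ :=
  U.Dom.indicator fun p => p.length * y ^ p.length

section Weights

variable {U : BinStr →. BinStr} {y : ℝ}

theorem weight_of_mem {p : BinStr} (hp : p ∈ U.Dom) : weight U y p = y ^ p.length :=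
  Set.indicator_of_mem hp _

theorem weight_of_notMem {p : BinStr} (hp : p ∉ U.Dom) : weight U y p = 0 :=
  Set.indicator_of_notMem hp _

theorem lengthWeight_of_mem {p : BinStr} (hp : p ∈ U.Dom) :
    lengthWeight U y p = p.length * y ^ p.length :=
  Set.indicator_of_mem hp _

theorem lengthWeight_of_notMem {p : BinStr} (hp : p ∉ U.Dom) : lengthWeight U y p = 0 :=
  Set.indicator_of_notMem hp _

theorem weight_nonneg (hy : 0 ≤ y) (p : BinStr) : 0 ≤ weight U y p :=
  Set.indicator_nonneg (fun _ _ => by positivity) p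

theorem lengthWeight_nonneg (hy : 0 ≤ y) (p : BinStr) : 0 ≤ lengthWeight U y p :=
  Set.indicator_nonneg (fun _ _ => by positivity) p

theorem nil_notMem_dom (hU : PrefixFree U.Dom) (hinf : U.Dom.Infinite) : [] ∉ U.Dom := by
  intro h
  refine hinf ((Set.finite_singleton ([] : BinStr)).subset fun p hp => ?_)
  exact (hU [] h p hp (List.nil_prefix)).symm

theorem summable_weight_half (hU : PrefixFree U.Dom) (hinf : U.Dom.Infinite) :
    Summable (weight U (1 / 2)) := by
  classical
  refine summable_of_sum_le (c := 1) (weight_nonneg (by norm_num)) fun F => ?_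
  have h : ∑ p ∈ F, weight U (1 / 2) p = ∑ p ∈ F.filter (· ∈ U.Dom), (1 / 2 : ℝ) ^ p.length := by
    rw [Finset.sum_filter]
    refine Finset.sum_congr rfl fun p _ => ?_
    split_ifs with hp
    · exact weight_of_mem hp
    · exact weight_of_notMem hp
  rw [h]
  exact hU.sum_le_one (nil_notMem_dom hU hinf) _ fun p hp => (Finset.mem_filter.1 hp).2

/-- The linear factor is absorbed by any increase of the base, since `l * (a / b) ^ l` tends to `0`.
-/
theorem exists_mul_pow_le {a b : ℝ} (ha : 0 ≤ a) (hab : a < b) :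
    ∃ C : ℝ, 0 < C ∧ ∀ l : ℕ, l * a ^ l ≤ C * b ^ l := by
  have hb : 0 < b := ha.trans_lt hab
  have h := tendsto_self_mul_const_pow_of_lt_one (r := a / b) (by positivity)
    ((div_lt_one hb).2 hab)
  obtain ⟨C, hC⟩ := h.bddAbove_range
  refine ⟨max C 1, by positivity, fun l => ?_⟩
  have h1 : (l : ℝ) * (a / b) ^ l ≤ max C 1 := (hC ⟨l, rfl⟩).trans (le_max_left _ _)
  rw [div_pow, ← mul_div_assoc, div_le_iff₀ (by positivity)] at h1
  exact h1

theorem summable_weight (hU : PrefixFree U.Dom) (hinf : U.Dom.Infinite) (hy : 0 ≤ y)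
    (hy2 : y ≤ 1 / 2) : Summable (weight U y) := by
  refine (summable_weight_half hU hinf).of_nonneg_of_le (weight_nonneg hy) fun p => ?_
  exact Set.indicator_le_indicator (by gcongr)

theorem summable_lengthWeight (hU : PrefixFree U.Dom) (hinf : U.Dom.Infinite) (hy : 0 ≤ y)
    (hy2 : y < 1 / 2) : Summable (lengthWeight U y) := by
  obtain ⟨C, hC, h⟩ := exists_mul_pow_le hy hy2
  refine ((summable_weight_half hU hinf).mul_left C).of_nonneg_of_le
    (lengthWeight_nonneg hy) fun p => ?_
  by_cases hp : p ∈ U.Dom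
  · rw [lengthWeight_of_mem hp, weight_of_mem hp]; exact h _
  · rw [lengthWeight_of_notMem hp, weight_of_notMem hp, mul_zero]

/-- If the `1 / 2`-weight outside `F` is small, then so is the energy outside `F`. -/
theorem exists_tail_bound (hU : PrefixFree U.Dom) (hinf : U.Dom.Infinite) (hy : 0 ≤ y) {b : ℝ}
    (hyb : y < b) (hb : b ≤ 1 / 2) : ∃ C : ℝ, 0 < C ∧ ∀ (F : Finset BinStr) (L : ℕ),
      ∑' p, weight U (1 / 2) p - ∑ p ∈ F, weight U (1 / 2) p ≤ (1 / 2) ^ L →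
      ∑' p, lengthWeight U y p - ∑ p ∈ F, lengthWeight U y p ≤ C * b ^ L := by
  obtain ⟨C, hC, h⟩ := exists_mul_pow_le hy hyb
  refine ⟨C, hC, fun F L hF => ?_⟩
  have hb0 : 0 ≤ b := hy.trans hyb.le
  have hso := summable_weight_half hU hinf
  have hsw := summable_lengthWeight hU hinf hy (hyb.trans_le hb)
  have hso' := hso.subtype (fun p => p ∉ F)
  have hsw' := hsw.subtype (fun p => p ∉ F)
  rw [sub_eq_of_eq_add' (hso.sum_add_tsum_subtype_compl F).symm] at hF
  rw [sub_eq_of_eq_add' (hsw.sum_add_tsum_subtype_compl F).symm]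
  have hle : ∀ p : {p // p ∉ F}, lengthWeight U y p ≤ C * (2 * b) ^ L * weight U (1 / 2) p := by
    rintro ⟨p, hp⟩
    by_cases hpd : p ∈ U.Dom
    -- A single term is at most the whole tail, so every program outside `F` has length at least
    -- `L`. As `2 * b ≤ 1`, its factor `(2 * b) ^ |p|` is at most `(2 * b) ^ L`.
    · have h1 : weight U (1 / 2) p ≤ (1 / 2) ^ L :=
        (hso'.le_tsum ⟨p, hp⟩ fun r _ => weight_nonneg (by norm_num) _).trans hF
      simp only
      rw [weight_of_mem hpd] at h1
      rw [lengthWeight_of_mem hpd, weight_of_mem hpd]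
      have h2 : L ≤ p.length := (pow_le_pow_iff_right_of_lt_one₀ (by norm_num) (by norm_num)).1 h1
      calc (p.length : ℝ) * y ^ p.length ≤ C * b ^ p.length := h _
        _ = C * (2 * b) ^ p.length * (1 / 2) ^ p.length := by
          rw [mul_assoc, ← mul_pow]; congr 2; ring
        _ ≤ C * (2 * b) ^ L * (1 / 2) ^ p.length := by
          gcongr C * ?_ * _
          exact pow_le_pow_of_le_one (by positivity) (by linarith) h2
    · simp only
      rw [lengthWeight_of_notMem hpd, weight_of_notMem hpd, mul_zero]
  calc ∑' p : {p // p ∉ F}, lengthWeight U y p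
      ≤ ∑' p : {p // p ∉ F}, C * (2 * b) ^ L * weight U (1 / 2) p :=
        hsw'.tsum_le_tsum hle (hso'.mul_left _)
    _ = C * (2 * b) ^ L * ∑' p : {p // p ∉ F}, weight U (1 / 2) p := tsum_mul_left
    _ ≤ C * (2 * b) ^ L * (1 / 2) ^ L := by gcongr
    _ = C * b ^ L := by rw [mul_assoc, ← mul_pow]; congr 2; ring

end Weights

/-! ### The energy and its finite truncations -/

/-- The mean length of the programs for `U` with respect to the weight `y ^ |p|`. -/
noncomputable def energy (U : BinStr →. BinStr) (y : ℝ) : ℝ :=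
  (∑' p, lengthWeight U y p) / ∑' p, weight U y p

section Energy

variable {U : BinStr →. BinStr} {y : ℝ}

theorem tsum_weight_pos (hy : 0 < y) (hne : U.Dom.Nonempty) (hz : Summable (weight U y)) :
    0 < ∑' p, weight U y p := by
  obtain ⟨p, hp⟩ := hne
  exact hz.tsum_pos (weight_nonneg hy.le) p (by rw [weight_of_mem hp]; positivity)

theorem energy_nonneg (hy : 0 ≤ y) : 0 ≤ energy U y :=
  div_nonneg (tsum_nonneg (lengthWeight_nonneg hy)) (tsum_nonneg (weight_nonneg hy))

theorem rpow_neg_div_eq (T : ℝ) (n : ℕ) : (2 : ℝ) ^ (-(n : ℝ) / T) = ((2 : ℝ) ^ (-1 / T)) ^ n := by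
  rw [← Real.rpow_natCast, ← Real.rpow_mul two_pos.le]
  congr 1; ring

/-- Both series of nonnegative terms are unconditionally summable, so the order of enumeration is
irrelevant. -/
theorem tendsto_partialEnergy {q : ℕ → BinStr} (hq : IsEnumeration q U.Dom) (T : ℝ)
    (hz : Summable (weight U (2 ^ (-1 / T)))) (hw : Summable (lengthWeight U (2 ^ (-1 / T)))) :
    Tendsto (fun n => partialEnergy q n T) atTop (𝓝 (energy U (2 ^ (-1 / T)))) := by
  have hmem : ∀ i, q i ∈ U.Dom := fun i => hq.2 ▸ Set.mem_range_self i
  have hout : ∀ p, p ∉ Set.range q → p ∉ U.Dom := fun p hp => hq.2 ▸ hp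
  have h1 := ((hq.1.hasSum_iff fun p hp => weight_of_notMem (hout p hp)).2
    hz.hasSum).tendsto_sum_nat
  have h2 := ((hq.1.hasSum_iff fun p hp => lengthWeight_of_notMem (hout p hp)).2
    hw.hasSum).tendsto_sum_nat
  have hne := (tsum_weight_pos (by positivity) ⟨_, hmem 0⟩ hz).ne'
  refine (h2.div h1 hne).congr fun n => ?_
  simp only [partialEnergy, partialZ, rpow_neg_div_eq, Function.comp_apply,
    weight_of_mem (hmem _), lengthWeight_of_mem (hmem _), Pi.div_apply]

theorem tsum_lengthWeight_eq (hy : 0 < y) (hne : U.Dom.Nonempty) (hz : Summable (weight U y)) :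
    ∑' p, lengthWeight U y p = energy U y * ∑' p, weight U y p :=
  (div_mul_cancel₀ _ (tsum_weight_pos hy hne hz).ne').symm

/-- By definition of the mean, `∑ (|p| - E) y ^ |p|` over all programs is zero; the part over `F` is
minus the part over the complement. -/
theorem energy_mul_sub_eq_tsum (hy : 0 < y) (hne : U.Dom.Nonempty) (hz : Summable (weight U y))
    (hw : Summable (lengthWeight U y)) (F : Finset BinStr) :
    energy U y * ∑ p ∈ F, weight U y p - ∑ p ∈ F, lengthWeight U y p =
      ∑' p : {p // p ∉ F}, (lengthWeight U y p - energy U y * weight U y p) := by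
  have hs : Summable fun p => lengthWeight U y p - energy U y * weight U y p :=
    hw.sub (hz.mul_left _)
  have h := hs.sum_add_tsum_subtype_compl F
  rw [hw.tsum_sub (hz.mul_left _), tsum_mul_left, tsum_lengthWeight_eq hy hne hz, sub_self,
    Finset.sum_sub_distrib, ← Finset.mul_sum] at h
  linarith

/-- When `F` contains all programs shorter than the mean, every term of the complementary sum is
nonnegative, hence bounded by the sum. -/
theorem length_sub_energy_mul_le (hy : 0 < y) (hne : U.Dom.Nonempty) (hz : Summable (weight U y))
    (hw : Summable (lengthWeight U y)) {F : Finset BinStr}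
    (hF : ∀ p ∈ U.Dom, p ∉ F → energy U y ≤ p.length) :
    0 ≤ energy U y * ∑ p ∈ F, weight U y p - ∑ p ∈ F, lengthWeight U y p ∧
    ∀ r ∈ U.Dom, r ∉ F → (r.length - energy U y) * y ^ r.length ≤
      energy U y * ∑ p ∈ F, weight U y p - ∑ p ∈ F, lengthWeight U y p := by
  rw [energy_mul_sub_eq_tsum hy hne hz hw F]
  have hnn : ∀ p : {p // p ∉ F}, 0 ≤ lengthWeight U y p - energy U y * weight U y p := by
    rintro ⟨p, hp⟩
    by_cases hpd : p ∈ U.Dom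
    · simp only [lengthWeight_of_mem hpd, weight_of_mem hpd, ← sub_mul]
      have := hF p hpd hp
      exact mul_nonneg (by linarith) (by positivity)
    · simp [lengthWeight_of_notMem hpd, weight_of_notMem hpd]
  have hs : Summable fun p : {p // p ∉ F} =>
      lengthWeight U y p - energy U y * weight U y p :=
    (hw.sub (hz.mul_left _)).subtype (fun p => p ∉ F)
  refine ⟨tsum_nonneg hnn, fun r hr hrF => ?_⟩
  have h := hs.le_tsum ⟨r, hrF⟩ fun p _ => hnn p
  rw [lengthWeight_of_mem hr, weight_of_mem hr, ← sub_mul] at h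
  exact h

theorem energy_mul_sub_le (hy : 0 < y) (hne : U.Dom.Nonempty) (hz : Summable (weight U y))
    (F : Finset BinStr) :
    energy U y * ∑ p ∈ F, weight U y p - ∑ p ∈ F, lengthWeight U y p ≤
      ∑' p, lengthWeight U y p - ∑ p ∈ F, lengthWeight U y p := by
  rw [tsum_lengthWeight_eq hy hne hz]
  have h1 := hz.sum_le_tsum F fun p _ => weight_nonneg hy.le p
  have h2 := mul_le_mul_of_nonneg_left h1 (energy_nonneg (U := U) hy.le)
  linarith

end Energy

/-! ### Recursive lower approximation of the energy -/

theorem pow_sub_pow_le_mul {a b : ℝ} (ha : 0 ≤ a) (hab : a ≤ b) (hb : b ≤ 1) (n : ℕ) :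
    b ^ n - a ^ n ≤ n * (b - a) := by
  induction n with
  | zero => simp
  | succ n ih =>
    have h1 : a ^ n ≤ 1 := pow_le_one₀ ha (hab.trans hb)
    have h2 : a ^ n ≤ b ^ n := by gcongr
    have h3 : b ^ (n + 1) - a ^ (n + 1) = b * (b ^ n - a ^ n) + a ^ n * (b - a) := by ring
    rw [h3]; push_cast
    nlinarith

theorem sum_le_mul_of_card_le {ι : Type*} {F : Finset ι} {f : ι → ℝ} {k : ℕ} {c : ℝ} (hc : 0 ≤ c)
    (hk : F.card ≤ k) (hf : ∀ i ∈ F, f i ≤ c) : ∑ i ∈ F, f i ≤ k * c := by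
  calc ∑ i ∈ F, f i ≤ F.card • c := Finset.sum_le_card_nsmul F f c hf
    _ = F.card * c := nsmul_eq_mul _ _
    _ ≤ k * c := by gcongr

/-- Computable rational approximations from below to `∑ |p| y ^ |p|` and from above to `∑ y ^ |p|`
over the stages. -/
theorem Stages.exists_approx {U : BinStr →. BinStr} (S : Stages U) {T : ℝ} (hT : 0 < T)
    (hT1 : T < 1) (hTc : IsComputableReal T) :
    ∃ A B D : ℕ → ℕ, Computable A ∧ Computable B ∧ ∀ k : ℕ, 0 < k → 0 < D k ∧
      (A k : ℝ) / D k ≤ ∑ p ∈ S.set k, lengthWeight U (2 ^ (-1 / T)) p ∧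
      ∑ p ∈ S.set k, lengthWeight U (2 ^ (-1 / T)) p ≤ (A k : ℝ) / D k + 2 * (1 / 2) ^ k ∧
      ∑ p ∈ S.set k, weight U (2 ^ (-1 / T)) p ≤ (B k : ℝ) / D k ∧
      (B k : ℝ) / D k ≤ ∑ p ∈ S.set k, weight U (2 ^ (-1 / T)) p + 2 * (1 / 2) ^ k := by
  obtain ⟨P, hP, hPy⟩ := exists_dyadic_approx hT hTc
  set y : ℝ := (2 : ℝ) ^ (-1 / T) with hy
  have hy0 : 0 < y := by positivity
  have hy2 : y ≤ 1 / 2 := two_rpow_neg_one_div_le_half hT hT1.le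
  have h4 : Computable fun x : ℕ × BinStr => 4 * x.1 :=
    computable_mul (Computable.const 4) Computable.fst
  have hP4 : Computable fun x : ℕ × BinStr => P (4 * x.1) := hP.comp h4
  have hlen : Computable fun x : ℕ × BinStr => x.2.length := computable_length Computable.snd
  have hscale : Computable fun x : ℕ × BinStr => 2 ^ (4 * x.1 * (x.1 - x.2.length)) :=
    computable_pow (Computable.const 2) (computable_mul h4 (computable_sub Computable.fst hlen))
  have hA : Computable₂ fun (k : ℕ) (p : BinStr) =>
      p.length * P (4 * k) ^ p.length * 2 ^ (4 * k * (k - p.length)) :=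
    computable_mul (computable_mul hlen (computable_pow hP4 hlen)) hscale
  have hB : Computable₂ fun (k : ℕ) (p : BinStr) =>
      (P (4 * k) + 2) ^ p.length * 2 ^ (4 * k * (k - p.length)) :=
    computable_mul (computable_pow (computable_add hP4 (Computable.const 2)) hlen) hscale
  -- With `4 * k` bits of `y`, each of the at most `k` programs, of length at most `k`, contributes
  -- an error of at most `2 * k ^ 2 / 2 ^ (4 * k)`; the total is at most `2 / 2 ^ k` because `k ≤ 2
  -- ^ k`. The denominator is common to all powers up to the `k`-th.
  refine ⟨_, _, fun k => 2 ^ (4 * k * k), S.computable_sum hA, S.computable_sum hB, fun k hk => ?_⟩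
  set lo : ℝ := P (4 * k) / 2 ^ (4 * k) with hlo
  set hi : ℝ := (P (4 * k) + 2) / 2 ^ (4 * k) with hhi
  have h2k : (0 : ℝ) < 2 ^ (4 * k) := by positivity
  obtain ⟨hy1, hy3⟩ := hPy (4 * k)
  have hlo0 : 0 ≤ lo := by positivity
  have hloy : lo ≤ y := by rw [hlo, div_le_iff₀ h2k]; linarith
  have hyhi : y ≤ hi := by rw [hhi, le_div_iff₀ h2k]; linarith
  have hdiff : hi - lo = 2 / 2 ^ (4 * k) := by rw [hhi, hlo]; ring
  have hpk : (k : ℝ) ≤ 2 ^ k := by exact_mod_cast Nat.lt_two_pow_self.le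
  have hk1 : (1 : ℝ) ≤ k := by exact_mod_cast hk
  have herr : (k : ℝ) * (k * k * (2 / 2 ^ (4 * k))) ≤ 2 * (1 / 2) ^ k := by
    have e : (2 : ℝ) ^ (4 * k) = 2 ^ k * (2 ^ k * 2 ^ k) * 2 ^ k := by ring
    rw [e, one_div, inv_pow]
    have h3 : (k : ℝ) * (k * k) ≤ 2 ^ k * (2 ^ k * 2 ^ k) := by gcongr
    have hpos : (0 : ℝ) < 2 ^ k := by positivity
    rw [← mul_assoc, mul_div_assoc', div_le_iff₀ (by positivity)]
    have e2 : 2 * ((2 : ℝ) ^ k)⁻¹ * (2 ^ k * (2 ^ k * 2 ^ k) * 2 ^ k) = 2 ^ k * (2 ^ k * 2 ^ k) * 2 := by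
      field_simp
    rw [e2]; linarith
  have hhi1 : hi ≤ 1 := by
    have h16 : (16 : ℝ) ≤ 2 ^ (4 * k) := by
      calc (16 : ℝ) = 2 ^ (4 * 1) := by norm_num
        _ ≤ 2 ^ (4 * k) := by
          apply pow_le_pow_right₀ one_le_two
          omega
    have : 2 / (2 : ℝ) ^ (4 * k) ≤ 1 / 8 := by
      rw [div_le_iff₀ h2k]; linarith
    linarith
  have hmem : ∀ p ∈ S.set k, p ∈ U.Dom := fun p hp => (S.mem_dom p).2 ⟨k, hp⟩
  have hlk : ∀ p ∈ S.set k, (p.length : ℝ) ≤ k := fun p hp => by exact_mod_cast S.length_le hp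
  have hsplit : ∀ p ∈ S.set k, ∀ c : ℝ, c ^ p.length * 2 ^ (4 * k * (k - p.length)) / 2 ^ (4 * k * k) =
      (c / 2 ^ (4 * k)) ^ p.length := by
    intro p hp c
    have e : 4 * k * k = 4 * k * p.length + 4 * k * (k - p.length) := by
      rw [← Nat.mul_add, Nat.add_sub_of_le (S.length_le hp)]
    rw [e, pow_add, div_pow, ← pow_mul, mul_div_mul_right _ _ (by positivity)]
  have eA : ((∑ p ∈ S.set k, p.length * P (4 * k) ^ p.length * 2 ^ (4 * k * (k - p.length)) : ℕ) : ℝ) /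
      (2 ^ (4 * k * k) : ℕ) = ∑ p ∈ S.set k, p.length * lo ^ p.length := by
    push_cast
    rw [Finset.sum_div]
    refine Finset.sum_congr rfl fun p hp => ?_
    rw [mul_assoc, mul_div_assoc, hsplit p hp]
  have eB : ((∑ p ∈ S.set k, (P (4 * k) + 2) ^ p.length * 2 ^ (4 * k * (k - p.length)) : ℕ) : ℝ) /
      (2 ^ (4 * k * k) : ℕ) = ∑ p ∈ S.set k, hi ^ p.length := by
    push_cast
    rw [Finset.sum_div]
    exact Finset.sum_congr rfl fun p hp => hsplit p hp _
  rw [eA, eB, Finset.sum_congr rfl fun p hp => lengthWeight_of_mem (hmem p hp),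
    Finset.sum_congr rfl fun p hp => weight_of_mem (hmem p hp)]
  have hc0 : (0 : ℝ) ≤ k * k * (2 / 2 ^ (4 * k)) := by positivity
  refine ⟨by positivity, ?_, ?_, ?_, ?_⟩
  · gcongr
  · rw [← sub_le_iff_le_add', ← Finset.sum_sub_distrib]
    refine (sum_le_mul_of_card_le hc0 (S.card_le k) fun p hp => ?_).trans herr
    have h1 := pow_sub_pow_le_mul hlo0 hloy (by linarith) p.length
    have h2 := hlk p hp
    have h3 : (0 : ℝ) ≤ p.length := Nat.cast_nonneg _
    calc (p.length : ℝ) * y ^ p.length - p.length * lo ^ p.length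
        = p.length * (y ^ p.length - lo ^ p.length) := by ring
      _ ≤ p.length * (p.length * (y - lo)) := by gcongr
      _ ≤ k * (k * (hi - lo)) := by
        have : 0 ≤ y - lo := by linarith
        gcongr
      _ = k * k * (2 / 2 ^ (4 * k)) := by rw [hdiff]; ring
  · gcongr
  · rw [← sub_le_iff_le_add', ← Finset.sum_sub_distrib]
    refine (sum_le_mul_of_card_le hc0 (S.card_le k) fun p hp => ?_).trans herr
    have h1 := pow_sub_pow_le_mul hy0.le hyhi hhi1 p.length
    have h2 := hlk p hp
    have h5 : 0 ≤ hi - y := by linarith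
    calc hi ^ p.length - y ^ p.length ≤ p.length * (hi - y) := h1
      _ ≤ k * (k * (hi - lo)) := by
        have : hi - y ≤ k * (hi - lo) := by nlinarith
        gcongr
      _ = k * k * (2 / 2 ^ (4 * k)) := by rw [hdiff]; ring

/-- A computable sequence of rationals `A k / B k` approximating the energy from below, with
two-sided control of the error by the part of the domain outside the `k`-th stage. -/
theorem Stages.exists_energy_approx {U : BinStr →. BinStr} (S : Stages U)
    (hU : PrefixFree U.Dom) (hinf : U.Dom.Infinite) {T : ℝ} (hT : 0 < T)
    (hT1 : T < 1) (hTc : IsComputableReal T) :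
    ∃ (A B : ℕ → ℕ) (k₀ : ℕ) (m M : ℝ), Computable A ∧ Computable B ∧ 0 < m ∧ 0 < M ∧
      ∀ k ≥ k₀, 0 < B k ∧ (A k : ℝ) / B k ≤ energy U (2 ^ (-1 / T)) ∧
        (∀ r ∈ U.Dom, r ∉ S.set k → 0 < r.length ∧
          m * (r.length * ((2 : ℝ) ^ (-1 / T)) ^ r.length) ≤
            energy U (2 ^ (-1 / T)) - (A k : ℝ) / B k) ∧
        energy U (2 ^ (-1 / T)) - (A k : ℝ) / B k ≤
          M * (∑' p, lengthWeight U (2 ^ (-1 / T)) p -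
            ∑ p ∈ S.set k, lengthWeight U (2 ^ (-1 / T)) p + (1 / 2) ^ k) := by
  obtain ⟨A, B, D, hA, hB, happ⟩ := S.exists_approx hT hT1 hTc
  set y : ℝ := (2 : ℝ) ^ (-1 / T) with hy
  have hy0 : 0 < y := by positivity
  have hy2 : y < 1 / 2 := two_rpow_neg_one_div_lt_half hT hT1
  have hne := hinf.nonempty
  have hz := summable_weight hU hinf hy0.le hy2.le
  have hw := summable_lengthWeight hU hinf hy0.le hy2
  obtain ⟨p₀, hp₀⟩ := hne
  obtain ⟨k₁, hk₁⟩ := S.exists_forall_mem {p₀}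
  -- The threshold is twice the mean, so that a missing `r` satisfies `|r| - E ≥ |r| / 2`.
  obtain ⟨k₂, hk₂⟩ := S.exists_forall_length_lt (⌈2 * energy U y⌉₊ + 1)
  set E := energy U y with hE
  set Z := ∑' p, weight U y p with hZ
  have hE0 : 0 ≤ E := energy_nonneg hy0.le
  have hZ0 : 0 < Z := tsum_weight_pos hy0 hinf.nonempty hz
  have hz0 : 0 < y ^ p₀.length := by positivity
  -- The constants come from bounding the denominator `B k / D k`: above by `Z + 2`, and below by
  -- the weight of the fixed program `p₀`, which lies in all these stages.
  refine ⟨A, B, max (max k₁ k₂) 1, 1 / (2 * (Z + 2)), 2 * (E + 1) / y ^ p₀.length, hA, hB,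
    by positivity, by positivity, fun k hk => ?_⟩
  have hkk₁ : k₁ ≤ k := (le_max_left _ _).trans ((le_max_left _ _).trans hk)
  have hkk₂ : k₂ ≤ k := (le_max_right _ _).trans ((le_max_left _ _).trans hk)
  have hk1 : 0 < k := (le_max_right _ _).trans hk
  obtain ⟨hD, hA1, hA2, hB1, hB2⟩ := happ k hk1
  have hlen : ∀ p ∈ U.Dom, p ∉ S.set k → 2 * E ≤ p.length ∧ 0 < p.length := by
    intro p hp hpk
    have h := hk₂ k hkk₂ p hp hpk
    refine ⟨(Nat.le_ceil _).trans ?_, by omega⟩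
    exact_mod_cast (Nat.le_succ _).trans h
  obtain ⟨hgap0, hgap⟩ := length_sub_energy_mul_le hy0 hinf.nonempty hz hw (F := S.set k)
    fun p hp hpk => by have := (hlen p hp hpk).1; linarith
  have hgap2 := energy_mul_sub_le hy0 hinf.nonempty hz (S.set k)
  have hZS : y ^ p₀.length ≤ ∑ p ∈ S.set k, weight U y p := by
    rw [← weight_of_mem hp₀]
    exact Finset.single_le_sum (fun p _ => weight_nonneg hy0.le p)
      (hk₁ k hkk₁ p₀ (by simp) hp₀)
  have hZS2 : ∑ p ∈ S.set k, weight U y p ≤ Z := hz.sum_le_tsum _ fun p _ => weight_nonneg hy0.le p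
  have hDr : (0 : ℝ) < D k := by exact_mod_cast hD
  have hBD : 0 < (B k : ℝ) / D k := by linarith
  have hB0 : 0 < (B k : ℝ) := by
    have := mul_pos hBD hDr
    rwa [div_mul_cancel₀ _ hDr.ne'] at this
  have hAB : (A k : ℝ) / B k = (A k : ℝ) / D k / ((B k : ℝ) / D k) :=
    (div_div_div_cancel_right₀ hDr.ne' _ _).symm
  rw [← hE] at *
  rw [hAB]
  set A' := (A k : ℝ) / D k
  set B' := (B k : ℝ) / D k
  set ZS := ∑ p ∈ S.set k, weight U y p
  set WS := ∑ p ∈ S.set k, lengthWeight U y p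
  set h := (1 / 2 : ℝ) ^ k with hh
  have hh0 : 0 < h := by positivity
  have hh1 : h ≤ 1 := pow_le_one₀ (by norm_num) (by norm_num)
  have hlow : E * ZS - WS ≤ (E - A' / B') * B' := by
    have e : (E - A' / B') * B' = E * B' - A' := by field_simp
    have := mul_le_mul_of_nonneg_left hB1 hE0
    rw [e]; linarith
  have hup : (E - A' / B') * B' ≤ 2 * (E + 1) * (∑' p, lengthWeight U y p - WS + h) := by
    have e : (E - A' / B') * B' = E * B' - A' := by field_simp
    have h1 := mul_le_mul_of_nonneg_left hB2 hE0
    have h2 : 0 ≤ ∑' p, lengthWeight U y p - WS := hgap0.trans hgap2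
    rw [e]; nlinarith
  have hpos : 0 ≤ E - A' / B' := nonneg_of_mul_nonneg_left (hgap0.trans hlow) hBD
  refine ⟨by exact_mod_cast hB0, by linarith, fun r hr hrk => ⟨(hlen r hr hrk).2, ?_⟩, ?_⟩
  · have h1 := hgap r hr hrk
    have h2 := (hlen r hr hrk).1
    have h3 : 0 < y ^ r.length := by positivity
    have h4 : (E - A' / B') * B' ≤ (E - A' / B') * (Z + 2) := by
      gcongr; linarith
    have h5 : (r.length : ℝ) / 2 * y ^ r.length ≤ (r.length - E) * y ^ r.length := by
      gcongr; linarith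
    rw [one_div, inv_mul_le_iff₀ (by positivity)]
    nlinarith
  · have h1 : (E - A' / B') * y ^ p₀.length ≤ (E - A' / B') * B' := by
      gcongr; linarith
    rw [div_mul_eq_mul_div, le_div_iff₀ hz0]
    linarith

theorem Stages.tendsto_of_approx {U : BinStr →. BinStr} (S : Stages U) {y E M : ℝ}
    (hw : Summable (lengthWeight U y)) {A B : ℕ → ℕ} {k₀ : ℕ}
    (hle : ∀ k ≥ k₀, (A k : ℝ) / B k ≤ E)
    (hge : ∀ k ≥ k₀, E - (A k : ℝ) / B k ≤ M * (∑' p, lengthWeight U y p -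
      ∑ p ∈ S.set k, lengthWeight U y p + (1 / 2) ^ k)) :
    Tendsto (fun k => (A k : ℝ) / B k) atTop (𝓝 E) := by
  have h1 := S.tendsto_sum hw fun p => lengthWeight_of_notMem
  have h2 : Tendsto (fun k => M * (∑' p, lengthWeight U y p -
      ∑ p ∈ S.set k, lengthWeight U y p + (1 / 2 : ℝ) ^ k)) atTop (𝓝 0) := by
    have := ((h1.const_sub (∑' p, lengthWeight U y p)).add
      (tendsto_pow_atTop_nhds_zero_of_lt_one (r := (1 / 2 : ℝ)) (by norm_num) (by norm_num))).const_mul M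
    simpa using this
  have h3 : Tendsto (fun k => E - (A k : ℝ) / B k) atTop (𝓝 0) :=
    squeeze_zero' (eventually_atTop.2 ⟨k₀, fun k hk => by have := hle k hk; linarith⟩)
      (eventually_atTop.2 ⟨k₀, hge⟩) h2
  simpa using h3.const_sub E

theorem isLeftComputable_of_approx {E : ℝ} {A B : ℕ → ℕ} (hA : Computable A) (hB : Computable B)
    {k₀ : ℕ} (h : ∀ k ≥ k₀, 0 < B k ∧ (A k : ℝ) / B k ≤ E)
    (ht : Tendsto (fun k => (A k : ℝ) / B k) atTop (𝓝 E)) : IsLeftComputable E := by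
  have hs : Computable fun n : ℕ => n + k₀ := computable_add Computable.id (Computable.const k₀)
  -- Left-computability concerns upper bounds for `-E`, hence the constant sign; the shift by `k₀`
  -- discards the stages without guarantee.
  refine ⟨fun n => (-1) ^ 1 * ((A (n + k₀) : ℚ) / (B (n + k₀) : ℚ)),
    ⟨fun n => A (n + k₀), fun n => B (n + k₀), fun _ => 1, hA.comp hs, hB.comp hs,
      Computable.const 1, fun n => ⟨(h _ (by omega)).1.ne', rfl⟩⟩, fun n _ => ?_, ?_⟩
  · have := (h (n + k₀) (by omega)).2
    push_cast; linarith
  · have := ((tendsto_add_atTop_iff_nat k₀).2 ht).neg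
    refine this.congr fun n => ?_
    push_cast; ring

/-! ### Binary prefixes of the energy and Chaitin randomness -/

/-- Bit `i` is the parity of `⌊2 ^ (i + 1) * fract E⌋`. Dividing `⌊2 ^ n * E⌋` by `2 ^ (n - 1 - i)`
gives this number plus the even number `⌊E⌋ * 2 ^ (i + 1)`. -/
theorem initSeg_binaryExpansion {E : ℝ} (hE : 0 ≤ E) (n : ℕ) :
    initSeg (binaryExpansion E) n = bits n ⌊2 ^ n * E⌋₊ := by
  refine List.map_congr_left fun i hi => ?_
  have hi := List.mem_range.1 hi
  have h1 : ⌊2 ^ n * E⌋₊ / 2 ^ (n - 1 - i) = ⌊Int.fract E * 2 ^ (i + 1)⌋₊ + ⌊E⌋₊ * 2 ^ (i + 1) := by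
    have e1 : Int.fract E = E - ⌊E⌋₊ := by
      rw [Int.fract, ← natCast_floor_eq_intCast_floor hE]
    have e2 : (2 : ℝ) ^ n * E / ((2 ^ (n - 1 - i) : ℕ) : ℝ) =
        Int.fract E * 2 ^ (i + 1) + ((⌊E⌋₊ * 2 ^ (i + 1) : ℕ) : ℝ) := by
      have e3 : n = (i + 1) + (n - 1 - i) := by omega
      have e4 : (2 : ℝ) ^ n = 2 ^ (i + 1) * 2 ^ (n - 1 - i) := by
        rw [← pow_add, ← e3]
      rw [e4, e1]; push_cast; field_simp; ring
    rw [← Nat.floor_div_natCast, e2, Nat.floor_add_natCast]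
    have := Int.fract_nonneg E
    positivity
  rw [h1]
  have h2 : (⌊Int.fract E * 2 ^ (i + 1)⌋₊ + ⌊E⌋₊ * 2 ^ (i + 1)) % 2 =
      ⌊Int.fract E * 2 ^ (i + 1)⌋₊ % 2 := by
    have : ⌊E⌋₊ * 2 ^ (i + 1) = ⌊E⌋₊ * 2 ^ i * 2 := by ring
    rw [this, Nat.add_mul_mod_self_right]
  rw [h2]
  simp only [binaryExpansion, Real.digits, Fin.ext_iff, Fin.val_ofNat]
  norm_num

/-- The integer part is a constant that an algorithm may have built in, so the prefix alone
determines `⌊2 ^ n * E⌋`. -/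
theorem floor_eq_mul_add_val {E : ℝ} (hE : 0 ≤ E) (n : ℕ) :
    ⌊2 ^ n * E⌋₊ = ⌊E⌋₊ * 2 ^ n + val (initSeg (binaryExpansion E) n) := by
  rw [initSeg_binaryExpansion hE, val_bits]
  have h : ⌊2 ^ n * E⌋₊ / 2 ^ n = ⌊E⌋₊ := by
    rw [← Nat.floor_div_natCast]; congr 1; push_cast; field_simp
  rw [← h]
  exact (Nat.div_add_mod' _ _).symm

/-- If `l < T * n + M`, then `2 ^ (-n)` is at most a constant times `y ^ l`, so the hypothesis
bounds `l` by a constant `C'`. But then `l * y ^ l ≥ y ^ C'`, which is impossible for large `n`. The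
factor `l` is what allows an arbitrary `M`. -/
theorem exists_forall_le_length_of_mul_pow_le {T : ℝ} (hT : 0 < T) (C M : ℝ) :
    ∃ n₀ : ℕ, ∀ n ≥ n₀, ∀ l : ℕ, 0 < l →
      l * ((2 : ℝ) ^ (-1 / T)) ^ l ≤ C * (1 / 2) ^ n → T * n + M ≤ l := by
  set C' : ℝ := max C 0 * 2 ^ (M / T) with hC'
  have hlim : Tendsto (fun n : ℕ => C * (1 / 2 : ℝ) ^ n) atTop (𝓝 0) := by
    simpa using (tendsto_pow_atTop_nhds_zero_of_lt_one (r := (1 / 2 : ℝ)) (by norm_num)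
      (by norm_num)).const_mul C
  have hpos : (0 : ℝ) < 2 ^ (-C' / T) := by positivity
  obtain ⟨n₀, hn₀⟩ := eventually_atTop.1 (hlim.eventually_lt_const hpos)
  refine ⟨n₀, fun n hn l hl hle => ?_⟩
  by_contra! hlt
  have hl1 : (1 : ℝ) ≤ l := by exact_mod_cast hl
  have hyl : ((2 : ℝ) ^ (-1 / T)) ^ l = 2 ^ (-(l : ℝ) / T) := (rpow_neg_div_eq T l).symm
  rw [hyl] at hle
  have hhalf : (1 / 2 : ℝ) ^ n = 2 ^ (-(n : ℝ)) := by
    rw [Real.rpow_neg two_pos.le, Real.rpow_natCast, one_div, inv_pow]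
  have h1 : (l : ℝ) ≤ C' := by
    have h2 : (2 : ℝ) ^ (-(n : ℝ)) ≤ 2 ^ (M / T) * 2 ^ (-(l : ℝ) / T) := by
      rw [← Real.rpow_add two_pos]
      apply Real.rpow_le_rpow_of_exponent_le one_le_two
      rw [← add_div, le_div_iff₀ hT]; linarith
    have h3 : C * (1 / 2 : ℝ) ^ n ≤ max C 0 * (2 ^ (M / T) * 2 ^ (-(l : ℝ) / T)) := by
      rw [hhalf]
      calc C * (2 : ℝ) ^ (-(n : ℝ)) ≤ max C 0 * 2 ^ (-(n : ℝ)) := by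
            gcongr; exact le_max_left _ _
        _ ≤ _ := by gcongr
    have h4 := hle.trans h3
    rw [← mul_assoc] at h4
    exact le_of_mul_le_mul_right h4 (by positivity)
  have h5 : (2 : ℝ) ^ (-C' / T) ≤ l * 2 ^ (-(l : ℝ) / T) := by
    calc (2 : ℝ) ^ (-C' / T) ≤ 2 ^ (-(l : ℝ) / T) := by
          apply Real.rpow_le_rpow_of_exponent_le one_le_two
          gcongr
      _ ≤ l * 2 ^ (-(l : ℝ) / T) := le_mul_of_one_le_left (by positivity) hl1
  have := hn₀ n hn
  linarith

theorem IsOptimal.isChaitinRandom_of_approx {U : BinStr →. BinStr} (hU : IsOptimal U)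
    (S : Stages U) {T E m : ℝ} (hT : 0 < T) (hE : 0 ≤ E) (hm : 0 < m) {A B : ℕ → ℕ}
    (hA : Computable A) (hB : Computable B) {k₀ : ℕ} (hB0 : ∀ k ≥ k₀, 0 < B k)
    (hr : ∀ k ≥ k₀, ∀ r ∈ U.Dom, r ∉ S.set k → 0 < r.length ∧
      m * (r.length * ((2 : ℝ) ^ (-1 / T)) ^ r.length) ≤ E - (A k : ℝ) / B k)
    (ht : Tendsto (fun k => (A k : ℝ) / B k) atTop (𝓝 E)) :
    IsChaitinRandom U T (binaryExpansion E) := by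
  let N : BinStr → ℕ := fun s => ⌊E⌋₊ * 2 ^ s.length + val s
  have hN : Computable N := computable_add (computable_mul (Computable.const _)
    (computable_pow (Computable.const 2) Computable.list_length)) computable_val
  -- The test says `A / B > (N s - 1) / 2 ^ n`. Asking for `N s / 2 ^ n` might never succeed when `2
  -- ^ n * E` is an integer; the offset costs only a factor `2` in the error.
  let pr : BinStr → ℕ → Bool := fun s j =>
    decide (N s * B (k₀ + j) < A (k₀ + j) * 2 ^ s.length + B (k₀ + j))
  have hpr : Computable₂ pr := by
    have hk : Computable fun x : BinStr × ℕ => k₀ + x.2 :=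
      computable_add (Computable.const k₀) Computable.snd
    exact computable_decide_lt (computable_mul (hN.comp Computable.fst) (hB.comp hk))
      (computable_add (computable_mul (hA.comp hk) (computable_pow (Computable.const 2)
        (computable_length Computable.fst))) (hB.comp hk))
  obtain ⟨f, hf, hf1, hf2⟩ := exists_partrec_search hpr
  -- A string of zeros as long as the output bound of the stage found cannot be the output of any
  -- program in that stage.
  have hφ : Partrec fun s => (f s).map fun j => bits (S.bound (k₀ + j)) 0 :=
    hf.map (computable_bits (S.computable_bound.comp
      (computable_add (Computable.const k₀) Computable.snd)) (Computable.const 0)).to₂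
  obtain ⟨c, hc⟩ := hU.exists_program_le_H_add hφ
  have key : ∀ n : ℕ, ∃ l : ℕ, 0 < l ∧ l ≤ H U (initSeg (binaryExpansion E) n) + c ∧
      l * ((2 : ℝ) ^ (-1 / T)) ^ l ≤ 2 / m * (1 / 2) ^ n := by
    intro n
    set s := initSeg (binaryExpansion E) n with hs
    have hsl : s.length = n := by simp [hs, initSeg]
    have hNs : N s = ⌊2 ^ n * E⌋₊ := by rw [floor_eq_mul_add_val hE, ← hs, ← hsl]
    have h2n : (0 : ℝ) < 2 ^ n := by positivity
    have hN1 : (N s : ℝ) ≤ 2 ^ n * E := by rw [hNs]; exact Nat.floor_le (by positivity)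
    have hN2 : 2 ^ n * E < N s + 1 := by rw [hNs]; exact Nat.lt_floor_add_one _
    have hiff : ∀ j, pr s j = true ↔ (N s : ℝ) < 2 ^ n * ((A (k₀ + j) : ℝ) / B (k₀ + j)) + 1 := by
      intro j
      have hBj : (0 : ℝ) < B (k₀ + j) := by exact_mod_cast hB0 (k₀ + j) (by omega)
      have e : 2 ^ n * ((A (k₀ + j) : ℝ) / B (k₀ + j)) + 1 =
          (A (k₀ + j) * 2 ^ n + B (k₀ + j)) / B (k₀ + j) := by field_simp
      simp only [pr, decide_eq_true_eq, hsl]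
      rw [e, lt_div_iff₀ hBj]
      exact_mod_cast Iff.rfl
    have hexists : ∃ j, pr s j = true := by
      have h1 : Tendsto (fun k => 2 ^ n * ((A k : ℝ) / B k) + 1) atTop (𝓝 (2 ^ n * E + 1)) :=
        (ht.const_mul _).add_const 1
      obtain ⟨k, hk1, hk2⟩ := ((h1.eventually_const_lt (by linarith : (N s : ℝ) < 2 ^ n * E + 1)).and
        (eventually_ge_atTop k₀)).exists
      obtain ⟨j, rfl⟩ := Nat.exists_eq_add_of_le hk2
      exact ⟨j, (hiff j).2 hk1⟩
    obtain ⟨j, hj⟩ := Part.dom_iff_mem.1 (hf2 s hexists)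
    have hj' := (hiff j).1 (hf1 s j hj)
    obtain ⟨p, hp, hpl⟩ := hc s _ (Part.mem_map _ hj)
    have hpk : p ∉ S.set (k₀ + j) := fun h => by
      have := S.length_lt_bound h hp
      rw [length_bits] at this
      exact this.false
    obtain ⟨h1, h2⟩ := hr (k₀ + j) (by omega) p (Part.dom_iff_mem.2 ⟨_, hp⟩) hpk
    refine ⟨p.length, h1, hpl, ?_⟩
    rw [div_mul_eq_mul_div, le_div_iff₀ hm, mul_comm _ m]
    refine h2.trans ?_
    rw [one_div, inv_pow, ← div_eq_mul_inv, le_div_iff₀ h2n]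
    linarith
  rw [IsChaitinRandom, tendsto_atTop]
  intro M
  obtain ⟨n₀, hn₀⟩ := exists_forall_le_length_of_mul_pow_le hT (2 / m) (M + c)
  filter_upwards [eventually_ge_atTop n₀] with n hn
  obtain ⟨l, hl, hlH, hle⟩ := key n
  have h1 := hn₀ n hn l hl hle
  have h2 : (l : ℝ) ≤ H U (initSeg (binaryExpansion E) n) + c := by exact_mod_cast hlH
  linarith

/-! ### Compressibility -/

theorem tendsto_log_add_div_atTop (R : ℕ) :
    Tendsto (fun n : ℕ => (Nat.log 2 (n + R) : ℝ) / n) atTop (𝓝 0) := by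
  have h1 : Tendsto (fun n : ℕ => Real.log ((n : ℝ) + R) / ((n : ℝ) + R)) atTop (𝓝 0) := by
    have h2 : Tendsto (fun x : ℝ => Real.log x / x) atTop (𝓝 0) :=
      (Real.isLittleO_log_id_atTop).tendsto_div_nhds_zero
    exact h2.comp (tendsto_atTop_add_const_right _ _ tendsto_natCast_atTop_atTop)
  have h3 : Tendsto (fun n : ℕ => (1 + (R : ℝ) / n)) atTop (𝓝 1) := by
    simpa using (tendsto_const_div_atTop_nhds_zero_nat (R : ℝ)).const_add 1
  have h4 : Tendsto (fun n : ℕ => Real.log ((n : ℝ) + R) / ((n : ℝ) + R) * (1 + (R : ℝ) / n) /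
      Real.log 2) atTop (𝓝 0) := by
    simpa using (h1.mul h3).div_const (Real.log 2)
  refine squeeze_zero' (Eventually.of_forall fun n => by positivity) ?_ h4
  filter_upwards [eventually_gt_atTop 0] with n hn
  have hnr : (0 : ℝ) < n := by exact_mod_cast hn
  have hRr : (0 : ℝ) ≤ R := Nat.cast_nonneg R
  have h5 : (Nat.log 2 (n + R) : ℝ) ≤ Real.log ((n : ℝ) + R) / Real.log 2 := by
    have := Real.natLog_le_logb (n + R) 2
    rw [Real.logb] at this
    exact_mod_cast this
  have h6 : Real.log ((n : ℝ) + R) / ((n : ℝ) + R) * (1 + (R : ℝ) / n) / Real.log 2 =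
      Real.log ((n : ℝ) + R) / Real.log 2 / n := by
    have : (n : ℝ) + R ≠ 0 := by positivity
    field_simp
  rw [h6]
  gcongr

theorem pair_lt_sq {a b n : ℕ} (ha : a < n) (hb : b < n) : Nat.pair a b < n ^ 2 := by
  refine (Nat.pair_lt_max_add_one_sq a b).trans_le ?_
  gcongr
  have := max_lt ha hb
  omega

/-- If the energy is approximated from below by `A k / B k` with an error of the order of the energy
outside the `k`-th stage, then its expansion is compressible at every rate above the temperature. -/
theorem IsOptimal.exists_H_le_of_approx {U : BinStr →. BinStr} (hU : IsOptimal U)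
    (hinf : U.Dom.Infinite) (S : Stages U) {T D E M : ℝ} (hT : 0 < T) (hTD : T < D) (hD : D ≤ 1)
    (hE : 0 ≤ E) (hM : 0 < M) {A B : ℕ → ℕ} (hA : Computable A) (hB : Computable B) {k₀ : ℕ}
    (hle : ∀ k ≥ k₀, (A k : ℝ) / B k ≤ E)
    (hge : ∀ k ≥ k₀, E - (A k : ℝ) / B k ≤ M * (∑' p, lengthWeight U (2 ^ (-1 / T)) p -
      ∑ p ∈ S.set k, lengthWeight U (2 ^ (-1 / T)) p + (1 / 2) ^ k)) :
    ∃ R c : ℕ, ∀ n : ℕ, (H U (initSeg (binaryExpansion E) n) : ℝ) ≤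
      D * n + 8 * Nat.log 2 (n + R) + c := by
  set y : ℝ := (2 : ℝ) ^ (-1 / T) with hy
  set b : ℝ := (2 : ℝ) ^ (-1 / D) with hb
  have hD0 : 0 < D := hT.trans hTD
  have hy0 : 0 < y := by positivity
  have hb0 : 0 < b := by positivity
  have hyb : y < b := by
    apply Real.rpow_lt_rpow_of_exponent_lt one_lt_two
    rw [neg_div, neg_div, neg_lt_neg_iff]
    exact one_div_lt_one_div_of_lt hT hTD
  have hb2 : b ≤ 1 / 2 := two_rpow_neg_one_div_le_half hD0 hD
  obtain ⟨C, hC, htail⟩ := exists_tail_bound hU.1.2 hinf hy0.le hyb hb2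
  have hso := summable_weight_half hU.1.2 hinf
  set Ω := ∑' p, weight U (1 / 2) p with hΩ
  have hΩ0 : 0 < Ω := tsum_weight_pos (by norm_num) hinf.nonempty hso
  have hΩ1 : Ω ≤ 1 := by
    refine le_of_tendsto' (S.tendsto_sum hso fun p => weight_of_notMem) fun k => ?_
    have hmem : ∀ p ∈ S.set k, p ∈ U.Dom := fun p hp => (S.mem_dom p).2 ⟨k, hp⟩
    rw [Finset.sum_congr rfl fun p hp => weight_of_mem (hmem p hp)]
    exact hU.1.2.sum_le_one (nil_notMem_dom hU.1.2 hinf) _ hmem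
  let O : ℕ → ℕ := fun k => ∑ p ∈ S.set k, 2 ^ (k - p.length)
  have hO : Computable O := by
    refine S.computable_sum (f := fun (k : ℕ) (p : BinStr) => 2 ^ (k - p.length)) ?_
    exact computable_pow (Computable.const 2)
      (computable_sub Computable.fst (computable_length Computable.snd))
  have hOr : ∀ k, (O k : ℝ) / 2 ^ k = ∑ p ∈ S.set k, weight U (1 / 2) p := by
    intro k
    simp only [O]
    push_cast
    rw [Finset.sum_div]
    refine Finset.sum_congr rfl fun p hp => ?_
    rw [weight_of_mem ((S.mem_dom p).2 ⟨k, hp⟩), div_eq_iff (by positivity)]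
    have e : k = p.length + (k - p.length) := (Nat.add_sub_of_le (S.length_le hp)).symm
    conv_rhs => rw [e, pow_add, ← mul_assoc, ← mul_pow]
    norm_num
  -- Searching only stages beyond `n` keeps the rounding error `(1 / 2) ^ k` below `(1 / 2) ^ n`;
  -- going beyond `k₀` makes the error bounds valid.
  let K : ℕ → ℕ → ℕ := fun n j => n + (k₀ + j)
  let pr : ℕ × BinStr → ℕ → Bool := fun x j =>
    decide (val x.2 * 2 ^ K x.1 j < O (K x.1 j) * 2 ^ x.2.length)
  have k2 : ∀ {α : Type} [Primcodable α], Computable fun _ : α => 2 := Computable.const 2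
  have hpr : Computable₂ pr := by
    have hK : Computable fun x : (ℕ × BinStr) × ℕ => K x.1.1 x.2 :=
      computable_add (Computable.fst.comp Computable.fst)
        (computable_add (Computable.const k₀) Computable.snd)
    have hw : Computable fun x : (ℕ × BinStr) × ℕ => x.1.2 := Computable.snd.comp Computable.fst
    exact computable_decide_lt (computable_mul (computable_val.comp hw) (computable_pow k2 hK))
      (computable_mul (hO.comp hK) (computable_pow k2 (computable_length hw)))
  obtain ⟨f, hf, hf1, hf2⟩ := exists_partrec_search hpr
  let nn : BinStr → ℕ := fun a => (val a).unpair.1.unpair.1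
  let rr : BinStr → ℕ := fun a => (val a).unpair.1.unpair.2
  have hnn : Computable nn := computable_unpair_fst (computable_unpair_fst computable_val)
  have hrr : Computable rr := computable_unpair_snd (computable_unpair_fst computable_val)
  -- The header `a` encodes `n`, a correction `r` and the length `L` of `w`. The payload `w` holds
  -- bits of `Ω` that select the stage, and adding `r` to `g` gives the exact floor of `2 ^ n * E`.
  let g : ℕ → ℕ → ℕ := fun n j => A (K n j) * 2 ^ n / B (K n j)
  have hF : Partrec fun x : BinStr × BinStr =>
      (f (nn x.1, x.2)).map fun j => bits (nn x.1) (g (nn x.1) j + rr x.1) := by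
    have hn1 : Computable fun x : BinStr × BinStr => nn x.1 := hnn.comp Computable.fst
    have hn2 : Computable fun x : (BinStr × BinStr) × ℕ => nn x.1.1 := hn1.comp Computable.fst
    have hK : Computable fun x : (BinStr × BinStr) × ℕ => K (nn x.1.1) x.2 :=
      computable_add hn2 (computable_add (Computable.const k₀) Computable.snd)
    refine Partrec.map (hf.comp (hn1.pair Computable.snd)) ?_
    exact computable_bits hn2 (computable_add (computable_div (computable_mul (hA.comp hK)
      (computable_pow k2 hn2)) (hB.comp hK)) (hrr.comp (Computable.fst.comp Computable.fst)))
  have hG : Computable fun a => (val a).unpair.2 := computable_unpair_snd computable_val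
  obtain ⟨c, hc⟩ := hU.exists_program_le hG hF
  set R₀ := ⌈M * (C + 1)⌉₊ + 1 with hR₀
  refine ⟨R₀ + 2, 9 + c, fun n => ?_⟩
  set L := ⌈D * n⌉₊ with hL
  have hLD : D * n ≤ L := Nat.le_ceil _
  have hLD' : (L : ℝ) < D * n + 1 := Nat.ceil_lt_add_one (by positivity)
  have hLn : L ≤ n := Nat.ceil_le.2 (by nlinarith [Nat.cast_nonneg (α := ℝ) n])
  have h2L : (0 : ℝ) < 2 ^ L := by positivity
  have h2n : (0 : ℝ) < 2 ^ n := by positivity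
  -- Taking one less than the ceiling makes `v < 2 ^ L * Ω` strict, so some finite stage already
  -- exceeds `v / 2 ^ L`. What is then missing from `Ω` is less than `2 ^ (-L)`.
  obtain ⟨v, hv⟩ : ∃ v, ⌈2 ^ L * Ω⌉₊ = v + 1 :=
    ⟨_, (Nat.succ_pred_eq_of_pos (Nat.ceil_pos.2 (by positivity))).symm⟩
  have hv1 : (v : ℝ) < 2 ^ L * Ω := Nat.lt_ceil.1 (by omega)
  have hv2 : 2 ^ L * Ω ≤ v + 1 := by
    have := Nat.le_ceil (2 ^ L * Ω)
    rw [hv] at this; exact_mod_cast this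
  have hvL : v < 2 ^ L := by
    have : (v : ℝ) < 2 ^ L := hv1.trans_le (mul_le_of_le_one_right h2L.le hΩ1)
    exact_mod_cast this
  set w := bits L v with hw
  have hwl : w.length = L := length_bits _ _
  have hwv : val w = v := by rw [hw, val_bits, Nat.mod_eq_of_lt hvL]
  have hiff : ∀ j, pr (n, w) j = true ↔
      (v : ℝ) < 2 ^ L * ∑ p ∈ S.set (K n j), weight U (1 / 2) p := by
    intro j
    simp only [pr, decide_eq_true_eq, hwv, hwl]
    rw [← hOr, mul_div_assoc', lt_div_iff₀ (by positivity), mul_comm ((2 : ℝ) ^ L)]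
    exact_mod_cast Iff.rfl
  have hexists : ∃ j, pr (n, w) j = true := by
    have h1 := (S.tendsto_sum hso fun p => weight_of_notMem).const_mul ((2 : ℝ) ^ L)
    obtain ⟨k, hk1, hk2⟩ := ((h1.eventually_const_lt hv1).and
      (eventually_ge_atTop (n + k₀))).exists
    obtain ⟨j, rfl⟩ := Nat.exists_eq_add_of_le hk2
    refine ⟨j, (hiff j).2 ?_⟩
    simpa only [K, add_assoc] using hk1
  obtain ⟨j, hj⟩ := Part.dom_iff_mem.1 (hf2 (n, w) hexists)
  have hj' := (hiff j).1 (hf1 _ j hj)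
  have hKk₀ : k₀ ≤ K n j := by simp only [K]; omega
  have hKn : n ≤ K n j := by simp only [K]; omega
  have hbL : b ^ L ≤ (1 / 2) ^ n := by
    have h1 : (1 / 2 : ℝ) ^ n = 2 ^ (-(n : ℝ)) := by
      rw [Real.rpow_neg two_pos.le, Real.rpow_natCast, one_div, inv_pow]
    rw [h1, hb, ← rpow_neg_div_eq]
    apply Real.rpow_le_rpow_of_exponent_le one_le_two
    rw [div_le_iff₀ hD0]; linarith
  have herr : 2 ^ n * E ≤ 2 ^ n * ((A (K n j) : ℝ) / B (K n j)) + M * (C + 1) := by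
    have h1 := htail (S.set (K n j)) L (by
      rw [one_div_pow, le_div_iff₀ h2L]
      linarith)
    have h2 : (1 / 2 : ℝ) ^ K n j ≤ (1 / 2) ^ n :=
      pow_le_pow_of_le_one (by norm_num) (by norm_num) hKn
    have h3 := hge (K n j) hKk₀
    have h4 : M * (∑' p, lengthWeight U y p - ∑ p ∈ S.set (K n j), lengthWeight U y p +
        (1 / 2) ^ K n j) ≤ M * (C * (1 / 2) ^ n + (1 / 2) ^ n) := by
      have := mul_le_mul_of_nonneg_left hbL hC.le
      gcongr; linarith
    have h5 := mul_le_mul_of_nonneg_left (h3.trans h4) h2n.le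
    have e : (2 : ℝ) ^ n * (M * (C * (1 / 2) ^ n + (1 / 2) ^ n)) = M * (C + 1) := by
      rw [one_div, inv_pow]; field_simp
    rw [e] at h5
    linarith
  have hgfloor : g n j = ⌊2 ^ n * ((A (K n j) : ℝ) / B (K n j))⌋₊ := by
    simp only [g]
    rw [← Nat.floor_div_eq_div (K := ℝ)]
    congr 1; push_cast; ring
  have hg1 : g n j ≤ ⌊2 ^ n * E⌋₊ := by
    rw [hgfloor]
    have := hle (K n j) hKk₀
    gcongr
  obtain ⟨r, hr⟩ := Nat.exists_eq_add_of_le hg1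
  have hrR : r < R₀ + 1 := by
    have h1 : ⌊2 ^ n * E⌋₊ < g n j + 1 + ⌈M * (C + 1)⌉₊ := by
      have h2 := Nat.lt_floor_add_one (2 ^ n * ((A (K n j) : ℝ) / B (K n j)))
      rw [← hgfloor] at h2
      have h3 := Nat.le_ceil (M * (C + 1))
      have h4 := Nat.floor_le (by positivity : 0 ≤ 2 ^ n * E)
      have : ((⌊2 ^ n * E⌋₊ : ℕ) : ℝ) < (g n j + 1 + ⌈M * (C + 1)⌉₊ : ℕ) := by
        push_cast; linarith
      exact_mod_cast this
    omega
  set X := n + (R₀ + 2) with hX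
  set N := Nat.pair (Nat.pair n r) L with hN
  -- The correction `r` is bounded independently of `n`, so `n` and `r` are below `X` and two nested
  -- pairings stay below `X ^ 4`. The header is charged twice, which yields the coefficient `8`.
  set a := bits (4 * (Nat.log 2 X + 1)) N with ha
  have hNX : N < 2 ^ (4 * (Nat.log 2 X + 1)) := by
    have h1 : Nat.pair n r < X ^ 2 := pair_lt_sq (by omega) (by omega)
    have h2 : N < (X ^ 2) ^ 2 := pair_lt_sq h1 (by nlinarith)
    calc N < (X ^ 2) ^ 2 := h2
      _ = X ^ 4 := by ring
      _ ≤ (2 ^ (Nat.log 2 X + 1)) ^ 4 := by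
        gcongr
        exact (Nat.lt_pow_succ_log_self one_lt_two X).le
      _ = _ := by rw [← pow_mul, mul_comm]
  have hav : val a = N := by rw [ha, val_bits, Nat.mod_eq_of_lt hNX]
  have hal : a.length = 4 * (Nat.log 2 X + 1) := length_bits _ _
  have hna : nn a = n := by simp only [nn, hav, hN, Nat.unpair_pair]
  have hra : rr a = r := by simp only [rr, hav, hN, Nat.unpair_pair]
  obtain ⟨p, hp, hpl⟩ := hc a w (initSeg (binaryExpansion E) n)
    (by simp only [hav, hN, Nat.unpair_pair, hwl]) (by
      rw [Part.mem_map_iff]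
      refine ⟨j, ?_, ?_⟩
      · simp only [hna]; exact hj
      · simp only [hna, hra]
        rw [initSeg_binaryExpansion hE, hr])
  have hH : H U (initSeg (binaryExpansion E) n) ≤ L + 8 * Nat.log 2 X + (8 + c) := by
    have := H_le_length hp
    omega
  have hHr : (H U (initSeg (binaryExpansion E) n) : ℝ) ≤ L + 8 * Nat.log 2 X + (8 + c) := by
    exact_mod_cast hH
  push_cast
  linarith

/-- For each `ε`, the bound with `D = min (T + ε / 2) 1` makes the excess over `T * n` eventually
less than `ε * n`; so this excess, cut off at `0`, is itself `o(n)`. -/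
theorem isCompressible_of_forall_H_le {U : BinStr →. BinStr} {T : ℝ} {α : ℕ → Bool}
    (hT1 : T < 1) (h : ∀ D : ℝ, T < D → D ≤ 1 → ∃ R c : ℕ, ∀ n : ℕ, (H U (initSeg α n) : ℝ) ≤
      D * n + 8 * Nat.log 2 (n + R) + c) : IsCompressible U T α := by
  refine ⟨fun n => max 0 (H U (initSeg α n) - T * n), ?_, fun n _ => by
    have := le_max_right (0 : ℝ) (H U (initSeg α n) - T * n)
    linarith⟩
  rw [Metric.tendsto_nhds]
  intro ε hε
  obtain ⟨R, c, hRc⟩ := h (min (T + ε / 2) 1) (lt_min (by linarith) hT1) (min_le_right _ _)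
  have h1 : Tendsto (fun n : ℕ => 8 * ((Nat.log 2 (n + R) : ℝ) / n) + (c : ℝ) / n) atTop (𝓝 0) := by
    simpa using ((tendsto_log_add_div_atTop R).const_mul 8).add
      (tendsto_const_div_atTop_nhds_zero_nat (c : ℝ))
  filter_upwards [h1.eventually_lt_const (half_pos hε), eventually_gt_atTop 0] with n hn hn0
  have hnr : (0 : ℝ) < n := by exact_mod_cast hn0
  rw [Real.dist_0_eq_abs, abs_of_nonneg (by positivity), div_lt_iff₀ hnr]
  refine max_lt (by positivity) ?_
  have h2 := hRc n
  have h3 : min (T + ε / 2) 1 * n ≤ (T + ε / 2) * n := by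
    gcongr; exact min_le_left _ _
  have h4 : 8 * (Nat.log 2 (n + R) : ℝ) + c < ε / 2 * n := by
    rw [← mul_div_assoc, ← add_div, div_lt_iff₀ hnr] at hn
    exact hn
  linarith

/-! ### Divergence for `T ≥ 1` -/

/-- Converts an upper bound on the length of a program into a lower bound on its contribution.
Length `0` must be excluded. -/
theorem mul_half_pow_antitone {l m : ℕ} (hl : 0 < l) (hlm : l ≤ m) :
    (m : ℝ) * (1 / 2) ^ m ≤ l * (1 / 2) ^ l := by
  induction m, hlm using Nat.le_induction with
  | base => exact le_rfl
  | succ m hm ih =>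
    refine le_trans ?_ ih
    have : (1 : ℝ) ≤ m := by exact_mod_cast hl.trans_le hm
    rw [pow_succ]; push_cast
    have h : (0 : ℝ) < (1 / 2) ^ m := by positivity
    nlinarith

/-- Every string of length `4 ^ k` has a program of length at most `4 ^ k + 2 * k + c`: a header of
length `k` announces the length, at cost `2 * k`. The factor `2 ^ (-2 * k)` lost in this way is
cancelled by the factor `4 ^ k` from the length, so the `2 ^ 4 ^ k` strings together contribute at
least `2 ^ (-c)` for each `k`. -/
theorem IsOptimal.not_summable_lengthWeight {U : BinStr →. BinStr} (hU : IsOptimal U)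
    (hinf : U.Dom.Infinite) : ¬ Summable (lengthWeight U (1 / 2)) := by
  intro hs
  have hG : Computable fun a : BinStr => 4 ^ a.length :=
    computable_pow (Computable.const 4) Computable.list_length
  obtain ⟨c, hc⟩ := hU.exists_program_le hG
    (F := fun x => Part.some x.2) Computable.snd
  have hQ : ∀ x : (_ : ℕ) × ℕ, ∃ p, bits (4 ^ x.1) x.2 ∈ U p ∧
      p.length ≤ 2 * x.1 + 4 ^ x.1 + c := by
    intro x
    obtain ⟨p, hp, hpl⟩ := hc (bits x.1 0) (bits (4 ^ x.1) x.2) _ (by simp only [length_bits])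
      (Part.mem_some _)
    rw [length_bits, length_bits] at hpl
    exact ⟨p, hp, hpl⟩
  choose Q hQU hQl using hQ
  have hterm : ∀ x, (1 / 2 : ℝ) ^ (4 ^ x.1) * (1 / 2) ^ c ≤ lengthWeight U (1 / 2) (Q x) := by
    intro x
    have hdom : Q x ∈ U.Dom := Part.dom_iff_mem.2 ⟨_, hQU x⟩
    have hpos : 0 < (Q x).length := by
      refine List.length_pos_iff.2 fun h => nil_notMem_dom hU.1.2 hinf (h ▸ hdom)
    rw [lengthWeight_of_mem hdom]
    refine le_trans ?_ (mul_half_pow_antitone hpos (hQl x))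
    rw [pow_add, pow_add, ← mul_assoc, ← mul_assoc]
    gcongr ?_ * _
    have h1 : (1 / 2 : ℝ) ^ (2 * x.1) * 4 ^ x.1 = 1 := by
      rw [pow_mul, ← mul_pow]; norm_num
    have h2 : (4 : ℝ) ^ x.1 ≤ ((2 * x.1 + 4 ^ x.1 + c : ℕ) : ℝ) := by
      push_cast
      have : (0 : ℝ) ≤ 2 * x.1 + c := by positivity
      linarith
    calc (1 / 2 : ℝ) ^ 4 ^ x.1 = (4 ^ x.1 * (1 / 2) ^ (2 * x.1)) * (1 / 2) ^ 4 ^ x.1 := by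
          rw [mul_comm (4 ^ x.1), h1, one_mul]
      _ ≤ _ := by gcongr
  have hbound : ∀ K : ℕ, K * (1 / 2 : ℝ) ^ c ≤ ∑' p, lengthWeight U (1 / 2) p := by
    intro K
    let I : Finset ((_ : ℕ) × ℕ) := (Finset.range K).sigma fun k => Finset.range (2 ^ 4 ^ k)
    have hinj : Set.InjOn Q I := by
      rintro ⟨k, v⟩ hx ⟨k', v'⟩ hx' h
      have hv : v < 2 ^ 4 ^ k := by simpa using (Finset.mem_sigma.1 hx).2
      have hv' : v' < 2 ^ 4 ^ k' := by simpa using (Finset.mem_sigma.1 hx').2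
      have h1 : bits (4 ^ k) v = bits (4 ^ k') v' :=
        Part.mem_unique (hQU ⟨k, v⟩) (h ▸ hQU ⟨k', v'⟩)
      have h2 := congrArg List.length h1
      rw [length_bits, length_bits] at h2
      obtain rfl := Nat.pow_right_injective (a := 4) (by norm_num) h2
      have h3 := congrArg val h1
      rw [val_bits, val_bits, Nat.mod_eq_of_lt hv, Nat.mod_eq_of_lt hv'] at h3
      rw [h3]
    calc K * (1 / 2 : ℝ) ^ c = ∑ x ∈ I, (1 / 2 : ℝ) ^ (4 ^ x.1) * (1 / 2) ^ c := by
          rw [Finset.sum_sigma]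
          have : ∀ k ∈ Finset.range K, ∑ v ∈ Finset.range (2 ^ 4 ^ k),
              (1 / 2 : ℝ) ^ (4 ^ k) * (1 / 2) ^ c = (1 / 2) ^ c := by
            intro k _
            rw [Finset.sum_const, Finset.card_range, nsmul_eq_mul, ← mul_assoc]
            push_cast
            rw [← mul_pow]; norm_num
          rw [Finset.sum_congr rfl this, Finset.sum_const, Finset.card_range, nsmul_eq_mul]
      _ ≤ ∑ x ∈ I, lengthWeight U (1 / 2) (Q x) := Finset.sum_le_sum fun x _ => hterm x
      _ = ∑ p ∈ I.image Q, lengthWeight U (1 / 2) p := (Finset.sum_image hinj).symm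
      _ ≤ ∑' p, lengthWeight U (1 / 2) p :=
        hs.sum_le_tsum _ fun p _ => lengthWeight_nonneg (by norm_num) p
  obtain ⟨K, hK⟩ := exists_nat_gt ((∑' p, lengthWeight U (1 / 2) p) / (1 / 2) ^ c)
  rw [div_lt_iff₀ (by positivity)] at hK
  exact absurd (hbound K) (not_le.2 hK)

theorem IsEnumeration.infinite {q : ℕ → BinStr} {S : Set BinStr} (hq : IsEnumeration q S) :
    S.Infinite :=
  hq.2 ▸ Set.infinite_range_of_injective hq.1

/-- As `y ≥ 1 / 2`, the numerators diverge. Convergence of the denominators is not needed: outside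
the finite set of programs shorter than `2 * M`, a weight times `M` is at most half of its term in
the numerator, and the finite remainder is eventually at most the other half. -/
theorem IsOptimal.tendsto_partialEnergy_atTop {U : BinStr →. BinStr} (hU : IsOptimal U)
    {q : ℕ → BinStr} (hq : IsEnumeration q U.Dom) {T : ℝ} (hT : 1 ≤ T) :
    Tendsto (fun n => partialEnergy q n T) atTop atTop := by
  have hmem : ∀ i, q i ∈ U.Dom := fun i => hq.2 ▸ Set.mem_range_self i
  set y : ℝ := (2 : ℝ) ^ (-1 / T) with hy
  have hy0 : 0 < y := by positivity
  have hT0 : 0 < T := by linarith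
  have hy1 : y ≤ 1 := Real.rpow_le_one_of_one_le_of_nonpos one_le_two
    (div_nonpos_of_nonpos_of_nonneg (by norm_num) hT0.le)
  have hy2 : 1 / 2 ≤ y := by
    have h1 : (2 : ℝ) ^ (-1 : ℝ) ≤ 2 ^ (-1 / T) := by
      apply Real.rpow_le_rpow_of_exponent_le one_le_two
      rw [le_div_iff₀ hT0]; linarith
    rwa [Real.rpow_neg_one, ← one_div] at h1
  have hW : Tendsto (fun n => ∑ i ∈ Finset.range n, ((q i).length : ℝ) * y ^ (q i).length)
      atTop atTop := by
    have h1 : ¬ Summable (lengthWeight U (1 / 2) ∘ q) := by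
      rw [hq.1.summable_iff fun p hp => lengthWeight_of_notMem (by rwa [hq.2] at hp)]
      exact hU.not_summable_lengthWeight hq.infinite
    rw [not_summable_iff_tendsto_nat_atTop_of_nonneg (f := lengthWeight U (1 / 2) ∘ q)
      fun i => lengthWeight_nonneg (by norm_num) _] at h1
    refine tendsto_atTop_mono (fun n => Finset.sum_le_sum fun i _ => ?_) h1
    rw [Function.comp_apply, lengthWeight_of_mem (hmem i)]
    gcongr
  rw [tendsto_atTop]
  intro M₀
  obtain ⟨M, hM⟩ := exists_nat_ge M₀
  let F : Finset ℕ := ((List.finite_length_lt Bool (2 * M)).preimage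
    (hq.1.injOn (s := q ⁻¹' {l | l.length < 2 * M}))).toFinset
  have hF : ∀ i, i ∉ F → 2 * M ≤ (q i).length := by
    intro i hi
    by_contra! h
    exact hi (by simpa [F] using h)
  filter_upwards [hW.eventually_ge_atTop (2 * (M * F.card)), eventually_gt_atTop 0] with n hn hn0
  simp only [partialEnergy, partialZ, rpow_neg_div_eq, ← hy]
  have hZ : 0 < ∑ i ∈ Finset.range n, y ^ (q i).length :=
    Finset.sum_pos (fun i _ => by positivity) ⟨0, Finset.mem_range.2 hn0⟩
  refine hM.trans ?_
  rw [le_div_iff₀ hZ, Finset.mul_sum]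
  have hle : ∀ i ∈ Finset.range n, (M : ℝ) * y ^ (q i).length ≤
      (q i).length * y ^ (q i).length / 2 + if i ∈ F then (M : ℝ) else 0 := by
    intro i _
    have hyl : 0 < y ^ (q i).length := by positivity
    have hyl1 : y ^ (q i).length ≤ 1 := pow_le_one₀ hy0.le hy1
    have hl0 : (0 : ℝ) ≤ (q i).length := Nat.cast_nonneg _
    have hM0 : (0 : ℝ) ≤ M := Nat.cast_nonneg _
    split_ifs with hi
    · have := mul_nonneg hl0 hyl.le
      nlinarith
    · have : (2 * M : ℝ) ≤ (q i).length := by exact_mod_cast hF i hi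
      nlinarith
  have hcard : ∑ i ∈ Finset.range n, (if i ∈ F then (M : ℝ) else 0) ≤ M * F.card := by
    rw [Finset.sum_ite_mem, Finset.sum_const, nsmul_eq_mul, mul_comm]
    gcongr
    exact Finset.inter_subset_right
  have h1 := Finset.sum_le_sum hle
  rw [Finset.sum_add_distrib, ← Finset.sum_div] at h1
  linarith

end AIT

theorem theorem4p3 (U : AIT.BinStr →. AIT.BinStr) (hU : AIT.IsOptimal U)
    (q : ℕ → AIT.BinStr) (hq : AIT.IsEnumeration q U.Dom) (T : ℝ) :
    (0 < T → T < 1 → AIT.IsComputableReal T →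
      ∃ E : ℝ, Tendsto (fun n : ℕ => AIT.partialEnergy q n T) atTop (𝓝 E) ∧
        AIT.IsLeftComputable E ∧
        AIT.IsChaitinRandom U T (AIT.binaryExpansion E) ∧
        AIT.IsCompressible U T (AIT.binaryExpansion E)) ∧
    (1 ≤ T → Tendsto (fun n : ℕ => AIT.partialEnergy q n T) atTop atTop) := by
  refine ⟨fun hT hT1 hTc => ?_, fun hT => hU.tendsto_partialEnergy_atTop hq hT⟩
  have hinf := hq.infinite
  have hpf := hU.1.2
  have hy0 : (0 : ℝ) < 2 ^ (-1 / T) := by positivity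
  have hy2 := AIT.two_rpow_neg_one_div_lt_half hT hT1
  have hz := AIT.summable_weight hpf hinf hy0.le hy2.le
  have hw := AIT.summable_lengthWeight hpf hinf hy0.le hy2
  obtain ⟨S⟩ := AIT.nonempty_stages hU.1.1
  obtain ⟨A, B, k₀, m, M, hA, hB, hm, hM, h⟩ := S.exists_energy_approx hpf hinf hT hT1 hTc
  have hE : 0 ≤ AIT.energy U (2 ^ (-1 / T)) := AIT.energy_nonneg hy0.le
  have hle := fun k hk => (h k hk).2.1
  have hge := fun k hk => (h k hk).2.2.2
  have ht := S.tendsto_of_approx hw hle hge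
  refine ⟨AIT.energy U (2 ^ (-1 / T)), AIT.tendsto_partialEnergy hq T hz hw,
    AIT.isLeftComputable_of_approx hA hB (fun k hk => ⟨(h k hk).1, hle k hk⟩) ht,
    hU.isChaitinRandom_of_approx S hT hE hm hA hB (fun k hk => (h k hk).1)
      (fun k hk => (h k hk).2.2.1) ht,
    AIT.isCompressible_of_forall_H_le hT1 fun D hTD hD =>
      hU.exists_H_le_of_approx hinf S hT hTD hD hE hM hA hB hle hge⟩
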